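/- For an oriented link $L\subset\mathbb R^3$ (nonempty, up to isotopy) and an integer $N\ge 1$ let $V_N(L)\in\mathbb Z[q^{\pm1}]$ denote the value of the unique isotopy invariant of oriented links that takes the value $1$ on the trivial knot and satisfies the skein relation $$q^{-N}V_N(L_+)-q^{N}V_N(L_-)=(q^{-1}-q)\,V_N(L_0),$$ where $L_+,L_-,L_0$ differ only at one crossing, which is positive, negative, or smoothed, respectively. Let $V(L)=V_2(L)$ be the Jones polynomial (with $t=q^2$), and let $[N]=q^{N-1}+q^{N-3}+\dots+q^{-N+1}$. For $z\in\mathbb C\setminus\{0\}$ and $P\in\mathbb Z[q^{\pm1}]$ let $\operatorname{null}_z P$ be the multiplicity of the root of $P$ at $q=z$. Lemma. (1) Let $L$ be a link with $n$ components. The Jones nullity $\operatorname{null}V(L):=\operatorname{null}_i V(L)$ equals the multiplicity of the factor $(q+q^{-1})$ in $V(L)$, that is, the largest $\nu$ such that $(q+q^{-1})^\nu$ divides $V(L)$ in $\mathbb Z[q^{\pm1}]$. Moreover $V(L)|_{q\mapsto 1}=2^{n-1}$, and $0\le\operatorname{null}V(L)\le n-1$. (2) More generally, let $N$ be a prime and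 let $\omega\in\mathbb C$ be a $2N$-th root of unity with $\omega\ne\pm1$ (for example a primitive one). Then for every link $L$ with $n$ components, $\operatorname{null}_\omega V_N(L)$ equals the multiplicity of the factor $[N]$ in $V_N(L)$, that is, the largest $\nu$ such that $[N]^\nu$ divides $V_N(L)$ in $\mathbb Z[q^{\pm1}]$; in particular it does not depend on the choice of $\omega$. Moreover $V_N(L)|_{q\mapsto 1}=N^{n-1}$, and $0\le\operatorname{null}_\omega V_N(L)\le n-1$. -/

import Mathlib

open scoped LaurentPolynomial
open LaurentPolynomial (T)

namespace OrientedLink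

/-! ### Oriented link diagrams and oriented links

A generic oriented link diagram in the plane, cut by horizontal lines, is a stack of layers. Each
layer consists of vertical strands together with exactly one cup (local minimum), cap (local
maximum) or crossing. Crossings are rotated so that both strands point upwards, which is always
possible up to isotopy of the plane. -/

/-- The direction of an oriented strand at a point of a horizontal line. -/
inductive Dir
  | up
  | down
  deriving DecidableEq

/-- The opposite direction. -/
def Dir.rev : Dir → Dir
  | .up => .down
  | .down => .up

/-- The elementary pieces of a diagram. The legs of `cup d` and of `cap d` have the directions
`d` (left leg) and `d.rev` (right leg). In a crossing both strands point upwards. In the positive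
crossing `cross true` the over-strand runs from bottom left to top right, in the negative crossing
`cross false` it runs from bottom right to top left. -/
inductive Piece
  | cup (d : Dir)
  | cap (d : Dir)
  | cross (positive : Bool)

namespace Piece

/-- The strands at the bottom of a piece, from left to right. -/
def src : Piece → List Dir
  | cup _ => []
  | cap d => [d, d.rev]
  | cross _ => [.up, .up]

/-- The strands at the top of a piece, from left to right. -/
def tgt : Piece → List Dir
  | cup d => [d, d.rev]
  | cap _ => []
  | cross _ => [.up, .up]

end Piece

/-- A list of layers, read from bottom to top. The layer `(i, g)` is the piece `g` with exactly `i`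
vertical strands on its left (and as many as needed on its right). -/
abbrev Word := List (ℕ × Piece)

/-- The layer `x` leads from the strands `o` at its bottom to the strands `o'` at its top. -/
def Step (x : ℕ × Piece) (o o' : List Dir) : Prop :=
  ∃ l r, l.length = x.1 ∧ o = l ++ x.2.src ++ r ∧ o' = l ++ x.2.tgt ++ r

/-- The word is a well-formed oriented tangle diagram from `o` (bottom) to `o'` (top). -/
def Path : Word → List Dir → List Dir → Prop
  | [], o, o' => o = o'
  | x :: w, o, o'' => ∃ o', Step x o o' ∧ Path w o' o''

/-- Put `i` vertical strands on the left of a tangle. -/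
def shift (i : ℕ) (w : Word) : Word := w.map fun x => (x.1 + i, x.2)

/-- The local moves. Together they generate isotopy of oriented tangles: isotopies of the plane
(`exchange` of the heights of distant pieces, the `zigzag` moves, `rotate`) and the Reidemeister
moves, the second one also for antiparallel strands. -/
inductive Move : Word → Word → Prop
  /-- `g` and `h` are horizontally disjoint, with `k` strands between them. -/
  | exchange (g h : Piece) (k : ℕ) :
      Move [(0, g), (g.tgt.length + k, h)] [(g.src.length + k, h), (0, g)]
  | zigzagRight (d : Dir) : Move [(0, .cup d), (1, .cap d.rev)] []
  | zigzagLeft (d : Dir) : Move [(1, .cup d.rev), (0, .cap d)] []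
  /-- Turning a crossing upside down clockwise or counterclockwise gives the same result. -/
  | rotate (e : Bool) :
      Move [(0, .cup .down), (1, .cup .down), (2, .cross e), (3, .cap .up), (2, .cap .up)]
        [(2, .cup .up), (3, .cup .up), (2, .cross e), (1, .cap .down), (0, .cap .down)]
  | r1Right (e : Bool) : Move [(1, .cup .up), (0, .cross e), (1, .cap .up)] []
  | r1Left (e : Bool) : Move [(0, .cup .down), (1, .cross e), (0, .cap .down)] []
  | r2 (e : Bool) : Move [(0, .cross e), (0, .cross !e)] []
  | r2UpDown (e : Bool) :
      Move [(0, .cup .down), (1, .cross e), (2, .cap .up),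
        (2, .cup .up), (1, .cross !e), (0, .cap .down)] []
  | r2DownUp (e : Bool) :
      Move [(2, .cup .up), (1, .cross e), (0, .cap .down),
        (0, .cup .down), (1, .cross !e), (2, .cap .up)] []
  | r3 : Move [(0, .cross true), (1, .cross true), (0, .cross true)]
      [(1, .cross true), (0, .cross true), (1, .cross true)]

/-- A nonempty closed oriented link diagram. -/
structure Diagram where
  word : Word
  ne_nil : word ≠ []
  closed : Path word [] []

/-- Two diagrams differ by one local move somewhere in the diagram. -/
def Diagram.Rel (D D' : Diagram) : Prop :=
  ∃ (u v a b : Word) (i : ℕ), Move a b ∧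
    D.word = u ++ shift i a ++ v ∧ D'.word = u ++ shift i b ++ v

/-- Isotopy classes of (nonempty) oriented links: diagrams up to the equivalence relation generated
by the local moves. -/
def Link := Quot Diagram.Rel

/-- The isotopy class of the link presented by a diagram. -/
def Diagram.link (D : Diagram) : Link := Quot.mk _ D

/-- Trace the arcs of a diagram from bottom to top and count the caps that close up a circle.
The list holds, for every strand met by the current horizontal line, the name of the arc below the
line that it belongs to; `k` is a fresh name. A cup starts a new arc. A cap that joins the two ends
of the same arc closes a circle, otherwise it merges two arcs. -/
def circles : ℕ → List ℕ → Word → ℕ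
  | _, _, [] => 0
  | k, s, (i, .cup _) :: w => circles (k + 1) (s.take i ++ k :: k :: s.drop i) w
  | k, s, (i, .cross _) :: w =>
      match s.drop i with
      | x :: y :: r => circles k (s.take i ++ y :: x :: r) w
      | _ => 0
  | k, s, (i, .cap _) :: w =>
      match s.drop i with
      | x :: y :: r =>
          if x = y then circles k (s.take i ++ r) w + 1
          else circles k ((s.take i ++ r).map fun z => if z = y then x else z) w
      | _ => 0

/-- The number of components of the link presented by a diagram. -/
def Diagram.components (D : Diagram) : ℕ := circles 0 [] D.word

/-- `L` is a link with `n` components: it is presented by a diagram consisting of `n` circles. -/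
def Link.HasComponents (L : Link) (n : ℕ) : Prop := ∃ D : Diagram, D.link = L ∧ D.components = n

/-! ### The state sum

The strands of a diagram are coloured by `Fin N`. A layer acts on functions of the colourings of
its top strands and yields functions of the colourings of its bottom strands. The variable `q` is
`T 1`. -/

section StateSum
variable {N : ℕ}

/-- The weight `q ^ (N - 1 - 2 a)` of a cap that runs clockwise, coloured by `a`. -/
noncomputable def capWeight (a : Fin N) : ℤ[T;T⁻¹] := T ((N : ℤ) - 1 - 2 * (a : ℕ))

/-- The weight `q ^ (-(N - 1 - 2 a))` of a cup that runs counterclockwise, coloured by `a`. -/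
noncomputable def cupWeight (a : Fin N) : ℤ[T;T⁻¹] := T (-((N : ℤ) - 1 - 2 * (a : ℕ)))

/-- The entry of the `R`-matrix at a crossing with bottom colours `a, b` and top colours `a, b`. -/
noncomputable def diagWeight : Bool → Fin N → Fin N → ℤ[T;T⁻¹]
  | true, a, b => T N * if a = b then T (-1) else if a < b then T (-1) - T 1 else 0
  | false, a, b => T (-N) * if a = b then T 1 else if b < a then T 1 - T (-1) else 0

/-- The entry of the `R`-matrix at a crossing with bottom colours `a, b` and top colours `b, a`
where `a ≠ b` (it is set to `0` for `a = b`, the case covered by `diagWeight`). -/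
noncomputable def swapWeight : Bool → Fin N → Fin N → ℤ[T;T⁻¹]
  | true, a, b => if a = b then 0 else T N
  | false, a, b => if a = b then 0 else T (-N)

/-- Functions of the colourings of a row of strands. -/
abbrev Fn (N : ℕ) := List (Fin N) → ℤ[T;T⁻¹]

/-- The action of a piece with no strands on its left. -/
noncomputable def opHead : Piece → Fn N → Fn N
  | .cup .up, f, s => ∑ c : Fin N, f (c :: c :: s)
  | .cup .down, f, s => ∑ c : Fin N, cupWeight c * f (c :: c :: s)
  | .cap .up, f, a :: b :: s => if a = b then capWeight a * f s else 0
  | .cap .down, f, a :: b :: s => if a = b then f s else 0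
  | .cross e, f, a :: b :: s =>
      diagWeight e a b * f (a :: b :: s) + swapWeight e a b * f (b :: a :: s)
  | _, _, _ => 0

/-- The action of a piece with `i` strands on its left. -/
noncomputable def opAt : ℕ → Piece → Fn N → Fn N
  | 0, g, f, s => opHead g f s
  | i + 1, g, f, c :: s => opAt i g (fun t => f (c :: t)) s
  | _ + 1, _, _, [] => 0

/-- The action of a tangle diagram. -/
noncomputable def op : Word → Fn N → Fn N
  | [], f => f
  | x :: w, f => opAt x.1 x.2 (op w f)

variable (N) in
/-- The state sum of a diagram: the sum over all colourings of the product of the weights. -/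
noncomputable def stateSum (D : Diagram) : ℤ[T;T⁻¹] := op (N := N) D.word (fun _ => 1) []

/-- The quantum integer `[N] = q^(N-1) + q^(N-3) + ⋯ + q^(-N+1)`, the state sum of a circle. -/
noncomputable def quantumInt (N : ℕ) : ℤ[T;T⁻¹] :=
  ∑ k ∈ Finset.range N, T ((N : ℤ) - 1 - 2 * k)

/-! #### Invariance of the state sum under the moves -/

theorem hq : (T 1 : ℤ[T;T⁻¹]) * T (-1) = 1 := by rw [← LaurentPolynomial.T_add]; simp
theorem hQ : (T N : ℤ[T;T⁻¹]) * T (-N) = 1 := by rw [← LaurentPolynomial.T_add]; simp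
theorem hwt (a : Fin N) : capWeight a * cupWeight a = 1 := by
  rw [capWeight, cupWeight, ← LaurentPolynomial.T_add, add_neg_cancel, LaurentPolynomial.T_zero]

theorem opHead_sum {ι : Type*} (t : Finset ι) (g : Piece) (f : ι → Fn N) (c : ι → ℤ[T;T⁻¹]) (s) :
    opHead g (fun s => ∑ j ∈ t, c j * f j s) s = ∑ j ∈ t, c j * opHead g (f j) s := by
  rcases g with (_ | _) | (_ | _) | e
  · simp only [opHead, Finset.mul_sum]
    rw [Finset.sum_comm]
  · simp only [opHead, Finset.mul_sum]
    rw [Finset.sum_comm]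
    simp only [mul_left_comm]
  all_goals
    match s with
    | [] => simp [opHead]
    | [_] => simp [opHead]
    | a :: b :: s =>
      simp only [opHead]
      try split_ifs
      all_goals
        simp only [mul_zero, Finset.sum_const_zero, Finset.mul_sum, ← Finset.sum_add_distrib]
        try exact Finset.sum_congr rfl fun _ _ => by ring

theorem opAt_sum {ι : Type*} (t : Finset ι) (i : ℕ) (g : Piece) (f : ι → Fn N)
    (c : ι → ℤ[T;T⁻¹]) (s) :
    opAt i g (fun s => ∑ j ∈ t, c j * f j s) s = ∑ j ∈ t, c j * opAt i g (f j) s := by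
  induction i generalizing s f with
  | zero => exact opHead_sum t g f c s
  | succ i ih =>
    cases s with
    | nil => simp [opAt]
    | cons a s => exact ih (fun j t => f j (a :: t)) s

theorem opAt_smul (i : ℕ) (g : Piece) (f : Fn N) (c : ℤ[T;T⁻¹]) (s) :
    opAt i g (fun s => c * f s) s = c * opAt i g f s := by
  simpa using opAt_sum {()} i g (fun _ => f) (fun _ => c) s

theorem opAt_zero (i : ℕ) (g : Piece) (s : List (Fin N)) :
    opAt i g (fun _ => 0) s = 0 := by
  simpa using opAt_sum ∅ i g (fun (_ : Unit) => 0) (fun _ => 0) s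

theorem opAt_add (i : ℕ) (g : Piece) (f f' : Fn N) (s) :
    opAt i g (fun s => f s + f' s) s = opAt i g f s + opAt i g f' s := by
  simpa using opAt_sum Finset.univ i g (fun (b : Bool) => if b then f else f') (fun _ => 1) s

theorem zz (d : Dir) (f : Fn N) (a s) : op [(0, .cup d), (1, .cap d.rev)] f (a :: s) = f (a :: s) := by
  have := hwt a
  cases d <;> simp [op, opAt, opHead, Dir.rev, -LaurentPolynomial.mul_T_assoc]
  linear_combination f (a :: s) * this

theorem zz' (d : Dir) (f : Fn N) (a s) : op [(1, .cup d.rev), (0, .cap d)] f (a :: s) = f (a :: s) := by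
  have := hwt a
  cases d <;> simp [op, opAt, opHead, Dir.rev, -LaurentPolynomial.mul_T_assoc]
  linear_combination f (a :: s) * this

theorem r2h (e : Bool) (f : Fn N) (a b s) :
    op [(0, .cross e), (0, .cross !e)] f (a :: b :: s) = f (a :: b :: s) := by
  have h1 := hq
  have h2 := hQ (N := N)
  cases e <;> simp only [op, opAt, opHead, Bool.not_true, Bool.not_false, diagWeight, swapWeight]
  all_goals
    generalize (T 1 : ℤ[T;T⁻¹]) = q at *
    generalize (T (-1) : ℤ[T;T⁻¹]) = q' at *
    generalize (T N : ℤ[T;T⁻¹]) = Q at *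
    generalize (T (-N) : ℤ[T;T⁻¹]) = Q' at *
    rcases lt_trichotomy a b with h | h | h 
    · simp only [h, h.ne, h.ne', h.not_gt, if_true, if_false]; grind
    · subst h; simp only [if_true]; grind
    · simp only [h, h.ne, h.ne', h.not_gt, if_true, if_false]; grind

theorem r3h (f : Fn N) (a b c s) :
    op [(0, .cross true), (1, .cross true), (0, .cross true)] f (a :: b :: c :: s) =
    op [(1, .cross true), (0, .cross true), (1, .cross true)] f (a :: b :: c :: s) := by
  have h1 := hq
  simp only [op, opAt, opHead, diagWeight, swapWeight]
  generalize (T 1 : ℤ[T;T⁻¹]) = q at *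
  generalize (T (-1) : ℤ[T;T⁻¹]) = q' at *
  generalize (T N : ℤ[T;T⁻¹]) = Q at *
  rcases lt_trichotomy a b with h | h | h <;> rcases lt_trichotomy a c with h' | h' | h' <;>
   rcases lt_trichotomy b c with h'' | h'' | h'' <;> first | omega | skip
  all_goals try subst h
  all_goals try subst h'
  all_goals try subst h''
  all_goals simp only [*, ne_of_lt, ne_of_gt, not_lt_of_gt, if_true, if_false, lt_irrefl]
  all_goals grind


theorem crP_comm (e : Bool) (a b : Fin N) : swapWeight e a b = swapWeight e b a := by
  cases e <;> simp [swapWeight, eq_comm]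

theorem crP_self (e : Bool) (a : Fin N) : swapWeight e a a = 0 := by
  cases e <;> simp [swapWeight]

theorem crP_mul (e : Bool) {a b : Fin N} (h : a ≠ b) : swapWeight e b a * swapWeight (!e) a b = 1 := by
  have := hQ (N := N)
  cases e <;> simp only [swapWeight, h, h.symm, if_false, Bool.not_true, Bool.not_false]
  · rw [mul_comm]; exact this
  · exact this

theorem crD_true {a b : Fin N} (h : b < a) : diagWeight true a b = 0 := by
  simp [diagWeight, h.ne', h.not_gt]

theorem crD_false {a b : Fin N} (h : a < b) : diagWeight false a b = 0 := by
  simp [diagWeight, h.ne, h.not_gt]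

theorem sum_tele (G : ℕ → ℤ[T;T⁻¹]) (h : Fin N → ℤ[T;T⁻¹])
    (hG : ∀ x : Fin N, h x = G (x + 1) - G x) : ∑ x, h x = G N - G 0 := by
  rw [Finset.sum_congr rfl fun x _ => hG x,
    Fin.sum_univ_eq_sum_range (fun x => G (x + 1) - G x), Finset.sum_range_sub]

theorem kinkR (e : Bool) (a : Fin N) : ∑ x, diagWeight e a x * capWeight x = 1 := by
  have ha := a.2
  cases e
  · rw [sum_tele fun x => if x ≤ (a : ℕ) then - T (-2 * (x : ℤ)) else 0]
    · simp
    · intro x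
      rcases lt_trichotomy a x with h | rfl | h
      · simp [diagWeight, h.ne, h.not_gt, h, show ¬ (x : ℕ) + 1 ≤ a by omega]
      · simp only [diagWeight, capWeight, if_true, ← LaurentPolynomial.T_add]
        simp; congr 1; ring
      · simp only [diagWeight, capWeight, h, h.ne', if_true, if_false, show (x : ℕ) + 1 ≤ a by omega,
          show (x : ℕ) ≤ a by omega, mul_sub, sub_mul, ← LaurentPolynomial.T_add]
        push_cast; ring_nf
  · rw [sum_tele fun x => if x ≤ (a : ℕ) then 0 else T (2 * (N : ℤ) - 2 * x)]
    · simp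
    · intro x
      rcases lt_trichotomy a x with h | rfl | h
      · simp only [diagWeight, capWeight, h, h.ne, if_true, if_false, show ¬ (x : ℕ) + 1 ≤ a by omega,
          show ¬ (x : ℕ) ≤ a by omega, mul_sub, sub_mul, ← LaurentPolynomial.T_add]
        push_cast; ring_nf
      · simp only [diagWeight, capWeight, if_true, ← LaurentPolynomial.T_add]
        simp; congr 1; ring
      · simp [diagWeight, h.ne', h.not_gt, h.le, show (x : ℕ) + 1 ≤ a by omega]

theorem kinkL (e : Bool) (a : Fin N) : ∑ x, cupWeight x * diagWeight e x a = 1 := by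
  have ha := a.2
  cases e
  · rw [sum_tele fun x => if x ≤ (a : ℕ) then 0 else T (2 * (x : ℤ) - 2 * N)]
    · simp
    · intro x
      rcases lt_trichotomy a x with h | rfl | h
      · simp only [diagWeight, cupWeight, h, h.ne', if_true, if_false, show ¬ (x : ℕ) + 1 ≤ a by omega,
          show ¬ (x : ℕ) ≤ a by omega, mul_sub, ← LaurentPolynomial.T_add]
        push_cast; ring_nf
      · simp only [diagWeight, cupWeight, if_true, ← LaurentPolynomial.T_add]
        simp; congr 1; ring
      · simp [diagWeight, h.ne, h.not_gt, h.le, show (x : ℕ) + 1 ≤ a by omega]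
  · rw [sum_tele fun x => if x ≤ (a : ℕ) then - T (2 * (x : ℤ)) else 0]
    · simp
    · intro x
      rcases lt_trichotomy a x with h | rfl | h
      · simp [diagWeight, h.ne', h.not_gt, h, show ¬ (x : ℕ) + 1 ≤ a by omega]
      · simp only [diagWeight, cupWeight, if_true, ← LaurentPolynomial.T_add]
        simp; congr 1; ring
      · simp only [diagWeight, cupWeight, h, h.ne, if_true, if_false, show (x : ℕ) + 1 ≤ a by omega,
          show (x : ℕ) ≤ a by omega, mul_sub, ← LaurentPolynomial.T_add]
        push_cast; ring_nf

theorem sideways (e : Bool) (a y : Fin N) :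
    ∑ x, diagWeight e a x * (cupWeight y * (diagWeight (!e) y x * capWeight x)) = if a = y then 1 else 0 := by
  split_ifs with h
  · subst h
    rw [Finset.sum_eq_single a]
    · cases e <;>
      · simp only [diagWeight, capWeight, cupWeight, if_true, Bool.not_true, Bool.not_false,
          ← LaurentPolynomial.T_add, ← LaurentPolynomial.T_zero]
        congr 1; ring
    · intro x _ hx
      rcases lt_or_gt_of_ne hx with h | h <;> cases e <;> simp [diagWeight, h.ne, h.ne', h.not_gt]
    · simp
  · rcases lt_or_gt_of_ne h with h | h
    · cases e
      · refine Finset.sum_eq_zero fun x _ => ?_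
        rcases lt_trichotomy x a with h' | h' | h' 
        · simp [crD_true (h'.trans h)]
        · subst h'; simp [crD_true h]
        · simp [crD_false h']
      · rw [sum_tele fun x => if (a : ℕ) < x ∧ x ≤ y then
          T (2 * (y : ℤ) - 2 * x + 2) - T (2 * (y : ℤ) - 2 * x) else 0]
        · simp [show ¬ (N ≤ (y : ℕ)) by omega]
        · intro x
          simp only [Bool.not_true, diagWeight, capWeight, cupWeight, Fin.ext_iff, Fin.lt_def] at *
          split_ifs
          all_goals try omega
          all_goals simp only [mul_sub, sub_mul, ← LaurentPolynomial.T_add, mul_zero, zero_mul, sub_zero]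
          all_goals push_cast; ring_nf
    · cases e
      · rw [sum_tele fun x => if (y : ℕ) < x ∧ x ≤ a then
          T (2 * (y : ℤ) - 2 * x + 2) - T (2 * (y : ℤ) - 2 * x) else 0]
        · simp [show ¬ (N ≤ (a : ℕ)) by omega]
        · intro x
          simp only [Bool.not_false, diagWeight, capWeight, cupWeight, Fin.ext_iff, Fin.lt_def] at *
          split_ifs
          all_goals try omega
          all_goals simp only [mul_sub, sub_mul, ← LaurentPolynomial.T_add, mul_zero, zero_mul, sub_zero]
          all_goals push_cast; ring_nf
      · refine Finset.sum_eq_zero fun x _ => ?_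
        rcases lt_trichotomy x a with h' | h' | h' 
        · simp [crD_true h']
        · subst h'; simp [crD_false h]
        · simp [crD_false (h.trans h')]

theorem sideways' (e : Bool) (a y : Fin N) :
    ∑ x, cupWeight x * (diagWeight e x a * (capWeight a * diagWeight (!e) x y)) = if a = y then 1 else 0 := by
  have h := mul_eq_one_comm.1 (show (Matrix.of fun a x : Fin N => diagWeight (!e) a x) *
      (Matrix.of fun x y : Fin N => cupWeight y * (diagWeight e y x * capWeight x)) = 1 by
    refine Matrix.ext fun a y => ?_
    simpa [Matrix.mul_apply, Matrix.one_apply] using sideways (!e) a y)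
  have := congrFun (congrFun h a) y
  simpa [Matrix.mul_apply, Matrix.one_apply, mul_assoc] using this

theorem roth (e : Bool) (f : Fn N) (a b s) :
    op [(0, .cup .down), (1, .cup .down), (2, .cross e), (3, .cap .up), (2, .cap .up)] f (a :: b :: s)
    = op  [(2, .cup .up), (3, .cup .up), (2, .cross e), (1, .cap .down), (0, .cap .down)] f (a :: b :: s) := by
  have h1 := hwt a
  have h2 := hwt b
  simp [op, opAt, opHead, -LaurentPolynomial.mul_T_assoc, mul_add, Finset.sum_add_distrib]
  grind

theorem r2ud (e : Bool) (f : Fn N) (a b s) :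
    op [(0, .cup .down), (1, .cross e), (2, .cap .up),
        (2, .cup .up), (1, .cross !e), (0, .cap .down)] f (a :: b :: s) = f (a :: b :: s) := by
  simp [op, opAt, opHead, -LaurentPolynomial.mul_T_assoc, mul_add, Finset.sum_add_distrib, crP_self]
  split_ifs with h h' h'
  · subst h
    simp only [crP_self, Finset.mul_sum]
    rw [Finset.sum_comm]
    have := fun y => congrArg (· * f (y :: y :: s)) (sideways' e a y)
    simp only [Finset.sum_mul, mul_assoc] at this
    simp [this]
  · exact absurd h.symm h'
  · exact absurd h'.symm h
  · linear_combination f (a :: b :: s) * swapWeight e b a * swapWeight (!e) a b * hwt b +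
      f (a :: b :: s) * crP_mul e h

theorem r2du (e : Bool) (f : Fn N) (a b s) :
      op [(2, .cup .up), (1, .cross e), (0, .cap .down),
        (0, .cup .down), (1, .cross !e), (2, .cap .up)]  f (a :: b :: s) = f (a :: b :: s) := by
  simp [op, opAt, opHead, -LaurentPolynomial.mul_T_assoc, mul_add, Finset.sum_add_distrib, crP_self]
  split_ifs with h h' h'
  · subst h
    simp only [crP_self, Finset.mul_sum]
    rw [Finset.sum_comm]
    have := fun y => congrArg (· * f (y :: y :: s)) (sideways e a y)
    simp only [Finset.sum_mul, mul_assoc] at this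
    simp [this]
  · exact absurd h.symm h'
  · exact absurd h'.symm h
  · linear_combination f (a :: b :: s) * swapWeight e b a * swapWeight (!e) a b * hwt a +
      f (a :: b :: s) * crP_mul e h

theorem r1r (e : Bool) (f : Fn N) (a s) :
    op [(1, .cup .up), (0, .cross e), (1, .cap .up)]  f (a :: s) = f (a :: s) := by
  simp [op, opAt, opHead, -LaurentPolynomial.mul_T_assoc, Finset.sum_add_distrib, crP_self]
  simp_rw [← mul_assoc]
  rw [← Finset.sum_mul, kinkR, one_mul]

theorem r1l (e : Bool) (f : Fn N) (a s) :
    op [(0, .cup .down), (1, .cross e), (0, .cap .down)]  f (a :: s) = f (a :: s) := by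
  simp [op, opAt, opHead, -LaurentPolynomial.mul_T_assoc, mul_add, Finset.sum_add_distrib, crP_self]
  simp_rw [← mul_assoc]
  rw [← Finset.sum_mul, kinkL, one_mul]

theorem exchange (g h : Piece) (k : ℕ) (f : Fn N) (s) :
    op [(0, g), (g.tgt.length + k, h)] f s = op [(g.src.length + k, h), (0, g)] f s := by
  rcases g with (_ | _) | (_ | _) | e
  · simp [op, opAt, opHead, Piece.src, Piece.tgt, add_comm _ k]
    have := opAt_sum Finset.univ k h (fun (c : Fin N) t => f (c :: c :: t)) (fun _ => 1) s
    simp only [one_mul] at this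
    exact this.symm
  · simp [op, opAt, opHead, Piece.src, Piece.tgt, add_comm _ k]
    exact (opAt_sum Finset.univ k h (fun (c : Fin N) t => f (c :: c :: t)) cupWeight s).symm
  all_goals
    match s with
    | [] => simp [op, opAt, opHead, Piece.src, add_comm _ k]
    | [_] => simp [op, opAt, opHead, Piece.src, add_comm _ k]
    | a :: b :: s =>
      simp only [op, opAt, opHead, Piece.src, Piece.tgt, List.length_cons, List.length_nil,
        add_comm _ k, add_zero, zero_add, ← add_assoc]
      try split_ifs
      all_goals simp only [opAt_add, opAt_smul, opAt_zero]

theorem op_append (u v : Word) (f : Fn N) : op (u ++ v) f = op u (op v f) := by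
  induction u with
  | nil => rfl
  | cons x u ih => simp [op, ih]

theorem opAt_congr (i : ℕ) (g : Piece) (r : ℕ) (f f' : Fn N)
    (h : ∀ t, t.length = i + g.tgt.length + r → f t = f' t) (s : List (Fin N))
    (hs : s.length = i + g.src.length + r) : opAt i g f s = opAt i g f' s := by
  induction i generalizing f f' s with
  | zero =>
    rcases g with (_ | _) | (_ | _) | e
    · simp only [opAt, opHead]
      exact Finset.sum_congr rfl fun c _ => h _ (by simp_all [Piece.src, Piece.tgt]; omega)
    · simp only [opAt, opHead]
      refine Finset.sum_congr rfl fun c _ => ?_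
      rw [h _ (by simp_all [Piece.src, Piece.tgt]; omega)]
    all_goals
      match s with
      | [] => rfl
      | [a] => rfl
      | a :: b :: s =>
        simp [Piece.src, Piece.tgt] at hs h
        simp only [opAt, opHead]
        first
        | rw [h s (by omega)]
        | rw [h _ (by simp; omega), h _ (by simp; omega)]
  | succ i ih =>
    cases s with
    | nil => simp [opAt]
    | cons a s =>
      refine ih _ _ (fun t ht => h _ ?_) s ?_
      · simp [ht]; omega
      · simp at hs; omega

theorem step_length {x : ℕ × Piece} {o o' : List Dir} (h : Step x o o') :
    ∃ r, o.length = x.1 + x.2.src.length + r ∧ o'.length = x.1 + x.2.tgt.length + r := by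
  obtain ⟨l, r, hl, rfl, rfl⟩ := h
  exact ⟨r.length, by simp [hl, add_assoc], by simp [hl, add_assoc]⟩

theorem op_congr (w : Word) (o o' : List Dir) (hw : Path w o o') (f f' : Fn N)
    (h : ∀ t, t.length = o'.length → f t = f' t) (s : List (Fin N))
    (hs : s.length = o.length) : op w f s = op w f' s := by
  induction w generalizing o s with
  | nil => cases hw; exact h s hs
  | cons x w ih =>
    obtain ⟨o₁, h₁, h₂⟩ := hw
    obtain ⟨r, hr, hr'⟩ := step_length h₁
    exact opAt_congr _ _ r _ _ (fun t ht => ih o₁ h₂ t (ht.trans hr'.symm)) s (hs.trans hr)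

theorem path_append {u v : Word} {o o' : List Dir} (h : Path (u ++ v) o o') :
    ∃ o₁, Path u o o₁ ∧ Path v o₁ o' := by
  induction u generalizing o with
  | nil => exact ⟨o, rfl, h⟩
  | cons x u ih =>
    obtain ⟨o₁, h₁, h₂⟩ := h
    obtain ⟨o₂, h₃, h₄⟩ := ih h₂
    exact ⟨o₂, ⟨o₁, h₁, h₃⟩, h₄⟩

theorem op_shift_one (w : Word) (f : Fn N) (c : Fin N) (s) :
    op (shift 1 w) f (c :: s) = op w (fun t => f (c :: t)) s := by
  induction w generalizing s with
  | nil => rfl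
  | cons x w ih =>
    have : (fun t => op (shift 1 w) f (c :: t)) = op w (fun t => f (c :: t)) := funext ih
    simp only [shift, List.map_cons, op, opAt] at *
    rw [this]

theorem shift_succ (i : ℕ) (w : Word) : shift (i + 1) w = shift 1 (shift i w) := by
  simp [shift, add_assoc]

theorem op_shift {a b : Word} {k : ℕ}
    (h : ∀ (f : Fn N) s, k ≤ s.length → op a f s = op b f s) (i : ℕ) (f : Fn N) (s)
    (hs : i + k ≤ s.length) : op (shift i a) f s = op (shift i b) f s := by
  induction i generalizing f s with
  | zero => simpa [shift] using h f s (by omega)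
  | succ i ih =>
    cases s with
    | nil => simp at hs
    | cons c s =>
      rw [shift_succ i a, shift_succ i b, op_shift_one, op_shift_one]
      exact ih _ _ (by simp at hs; omega)

theorem move_op {a b : Word} (h : Move a b) : ∃ k,
    (∀ (f : Fn N) s, k ≤ s.length → op a f s = op b f s) ∧
      ∀ i o o', Path (shift i a) o o' → i + k ≤ o.length := by
  have key : ∀ (x : ℕ × Piece) (w : Word) (i : ℕ) (o o' : List Dir),
      Path (shift i (x :: w)) o o' → ∃ o₁ r, Path (shift i w) o₁ o' ∧
        o.length = x.1 + i + x.2.src.length + r ∧ o₁.length = x.1 + i + x.2.tgt.length + r := by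
    rintro x w i o o' ⟨o₁, h₁, h₂⟩
    obtain ⟨r, hr⟩ := step_length h₁
    exact ⟨o₁, r, h₂, hr⟩
  have one : ∀ {a b : Word}, (∀ (f : Fn N) c s, op a f (c :: s) = op b f (c :: s)) →
      ∀ (f : Fn N) s, 1 ≤ s.length → op a f s = op b f s := by
    rintro a b h f (_ | ⟨c, s⟩) hs
    · simp at hs
    · exact h f c s
  have two : ∀ {a b : Word}, (∀ (f : Fn N) c d s, op a f (c :: d :: s) = op b f (c :: d :: s)) →
      ∀ (f : Fn N) s, 2 ≤ s.length → op a f s = op b f s := by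
    rintro a b h f (_ | ⟨c, _ | ⟨d, s⟩⟩) hs
    · simp at hs
    · simp at hs
    · exact h f c d s
  have three : ∀ {a b : Word},
      (∀ (f : Fn N) c d e s, op a f (c :: d :: e :: s) = op b f (c :: d :: e :: s)) →
      ∀ (f : Fn N) s, 3 ≤ s.length → op a f s = op b f s := by
    rintro a b h f (_ | ⟨c, _ | ⟨d, _ | ⟨e, s⟩⟩⟩) hs
    · simp at hs
    · simp at hs
    · simp at hs
    · exact h f c d e s
  cases h with
  | exchange g h k =>
    refine ⟨0, fun f s _ => exchange g h k f s, fun i o o' hp => ?_⟩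
    obtain ⟨o₁, r, -, h1, -⟩ := key _ _ _ _ _ hp
    simp only at h1; omega
  | zigzagRight d =>
    refine ⟨1, one (zz d), fun i o o' hp => ?_⟩
    obtain ⟨o₁, r, hp, h1, h2⟩ := key _ _ _ _ _ hp
    obtain ⟨o₂, r', hp, h3, h4⟩ := key _ _ _ _ _ hp
    simp [Piece.src, Piece.tgt] at *; omega
  | zigzagLeft d =>
    refine ⟨1, one (zz' d), fun i o o' hp => ?_⟩
    obtain ⟨o₁, r, hp, h1, h2⟩ := key _ _ _ _ _ hp
    simp [Piece.src, Piece.tgt] at *; omega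
  | rotate e =>
    refine ⟨2, two (roth e), fun i o o' hp => ?_⟩
    obtain ⟨o₁, r, hp, h1, h2⟩ := key _ _ _ _ _ hp
    obtain ⟨o₂, r', hp, h3, h4⟩ := key _ _ _ _ _ hp
    obtain ⟨o₃, r', hp, h5, h6⟩ := key _ _ _ _ _ hp
    obtain ⟨o₄, r', hp, h7, h8⟩ := key _ _ _ _ _ hp
    obtain ⟨o₅, r', hp, h9, h10⟩ := key _ _ _ _ _ hp
    simp [Piece.src, Piece.tgt] at *; omega
  | r1Right e =>
    refine ⟨1, one (r1r e), fun i o o' hp => ?_⟩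
    obtain ⟨o₁, r, hp, h1, h2⟩ := key _ _ _ _ _ hp
    simp [Piece.src, Piece.tgt] at *; omega
  | r1Left e =>
    refine ⟨1, one (r1l e), fun i o o' hp => ?_⟩
    obtain ⟨o₁, r, hp, h1, h2⟩ := key _ _ _ _ _ hp
    obtain ⟨o₂, r', hp, h3, h4⟩ := key _ _ _ _ _ hp
    simp [Piece.src, Piece.tgt] at *; omega
  | r2 e =>
    refine ⟨2, two (r2h e), fun i o o' hp => ?_⟩
    obtain ⟨o₁, r, hp, h1, h2⟩ := key _ _ _ _ _ hp
    simp [Piece.src, Piece.tgt] at *; omega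
  | r2UpDown e =>
    refine ⟨2, two (r2ud e), fun i o o' hp => ?_⟩
    obtain ⟨o₁, r, hp, h1, h2⟩ := key _ _ _ _ _ hp
    obtain ⟨o₂, r', hp, h3, h4⟩ := key _ _ _ _ _ hp
    obtain ⟨o₃, r'', hp, h5, h6⟩ := key _ _ _ _ _ hp
    simp [Piece.src, Piece.tgt] at *; omega
  | r2DownUp e =>
    refine ⟨2, two (r2du e), fun i o o' hp => ?_⟩
    obtain ⟨o₁, r, hp, h1, h2⟩ := key _ _ _ _ _ hp
    simp [Piece.src, Piece.tgt] at *; omega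
  | r3 =>
    refine ⟨3, three r3h, fun i o o' hp => ?_⟩
    obtain ⟨o₁, r, hp, h1, h2⟩ := key _ _ _ _ _ hp
    obtain ⟨o₂, r', hp, h3, h4⟩ := key _ _ _ _ _ hp
    simp [Piece.src, Piece.tgt] at *; omega

theorem stateSum_rel (D D' : Diagram) (h : Diagram.Rel D D') : stateSum N D = stateSum N D' := by
  obtain ⟨u, v, a, b, i, h, hD, hD'⟩ := h
  obtain ⟨k, h₁, h₂⟩ := move_op (N := N) h
  have hp := D.closed
  rw [hD, List.append_assoc] at hp
  obtain ⟨o, hu, hp⟩ := path_append hp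
  obtain ⟨o', ha, hv⟩ := path_append hp
  have := h₂ _ _ _ ha
  rw [stateSum, stateSum, hD, hD', List.append_assoc, List.append_assoc, op_append, op_append,
    op_append, op_append]
  exact op_congr u _ _ hu _ _ (fun t ht => op_shift h₁ i _ t (by omega)) _ rfl

/-! #### Divisibility of the state sum by `[N]`

The state sum commutes with a raising operator of the quantum group of `sl_N`, so that a diagram cut
open at one point acts as a scalar. -/

/-- The diagonal factor of the raising operator from the colour `j` to `j'`, on upward strands. -/
noncomputable def kw (j j' a : Fin N) : ℤ[T;T⁻¹] :=
  if a = j then T (-1) else if a = j' then T 1 else 1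

/-- The diagonal factor of the raising operator on downward strands. -/
noncomputable def kw' (j j' a : Fin N) : ℤ[T;T⁻¹] :=
  if a = j then T 1 else if a = j' then T (-1) else 1

/-- The raising operator from the colour `j` to `j'`. -/
noncomputable def raise (j j' : Fin N) : List Dir → Fn N → Fn N
  | .up :: o, f, a :: s => (if a = j then f (j' :: s) else 0) +
      kw j j' a * raise j j' o (fun t => f (a :: t)) s
  | .down :: o, f, a :: s => (if a = j' then -T (-1) * f (j :: s) else 0) +
      kw' j j' a * raise j j' o (fun t => f (a :: t)) s
  | _, _, _ => 0

theorem raise_sum {ι : Type*} (j j' : Fin N) (o : List Dir) (t : Finset ι) (f : ι → Fn N)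
    (c : ι → ℤ[T;T⁻¹]) (s) :
    raise j j' o (fun s => ∑ i ∈ t, c i * f i s) s = ∑ i ∈ t, c i * raise j j' o (f i) s := by
  induction o generalizing s f with
  | nil => simp [raise]
  | cons d o ih =>
    cases s with
    | nil => cases d <;> simp [raise]
    | cons a s =>
      cases d <;> simp only [raise, ih fun i t => f i (a :: t)] <;> split_ifs <;>
        simp only [Finset.mul_sum, ← Finset.sum_add_distrib, zero_add] <;>
        exact Finset.sum_congr rfl fun _ _ => by ring

theorem raise_smul (j j' : Fin N) (o : List Dir) (f : Fn N) (c : ℤ[T;T⁻¹]) (s) :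
    raise j j' o (fun s => c * f s) s = c * raise j j' o f s := by
  simpa using raise_sum j j' o {()} (fun _ => f) (fun _ => c) s

theorem raise_zero (j j' : Fin N) (o : List Dir) (s) : raise j j' o (fun _ => 0) s = 0 := by
  simpa using raise_sum j j' o ∅ (fun (_ : Unit) => 0) (fun _ => 0) s

theorem raise_add (j j' : Fin N) (o : List Dir) (f f' : Fn N) (s) :
    raise j j' o (fun s => f s + f' s) s = raise j j' o f s + raise j j' o f' s := by
  simpa using raise_sum j j' o Finset.univ (fun (b : Bool) => if b then f else f') (fun _ => 1) s

theorem kw_mul (j j' a : Fin N) : kw j j' a * kw' j j' a = 1 := by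
  have := hq
  simp only [kw, kw']
  split_ifs
  · rw [mul_comm]; exact this
  · exact this
  · simp

theorem raise_cross (j j' : Fin N) (hj : (j' : ℕ) = j + 1) (e : Bool) (f : Fn N) (a b : Fin N) (s) (r) :
    raise j j' (.up :: .up :: r) (opHead (.cross e) f) (a :: b :: s) =
      opHead (.cross e) (raise j j' (.up :: .up :: r) f) (a :: b :: s) := by
  have h1 := hq
  simp only [raise, opHead, raise_add, raise_smul]
  generalize raise j j' r (fun t => f (a :: b :: t)) s = x
  generalize raise j j' r (fun t => f (b :: a :: t)) s = y
  have hj' : j < j' := by omega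
  cases e <;> simp only [diagWeight, swapWeight, kw]
  all_goals
    generalize (T 1 : ℤ[T;T⁻¹]) = q at *
    generalize (T (-1) : ℤ[T;T⁻¹]) = q' at *
    generalize (T N : ℤ[T;T⁻¹]) = Q at *
    generalize (T (-N) : ℤ[T;T⁻¹]) = Q' at *
  all_goals
    by_cases ha : a = j
    · subst ha
      by_cases hb : b = a
      · subst hb; grind
      by_cases hb' : b = j'
      · subst hb'; grind
      · grind
    by_cases ha' : a = j'
    · subst ha'
      by_cases hb : b = j
      · subst hb; grind
      by_cases hb' : b = a
      · subst hb'; grind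
      · grind
    grind

theorem wtInv_succ {j j' : Fin N} (hj : (j' : ℕ) = j + 1) : cupWeight j' * T (-1) = cupWeight j * T 1 := by
  simp only [cupWeight, hj, ← LaurentPolynomial.T_add]
  push_cast; ring_nf

theorem wt_succ {j j' : Fin N} (hj : (j' : ℕ) = j + 1) : capWeight j' = T (-1) * T (-1) * capWeight j := by
  simp only [capWeight, hj, ← LaurentPolynomial.T_add]
  push_cast; ring_nf

theorem raise_opHead (j j' : Fin N) (hj : (j' : ℕ) = j + 1) (g : Piece) (r : List Dir) (f : Fn N) (s)
    (hs : s.length = g.src.length + r.length) :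
    raise j j' (g.src ++ r) (opHead g f) s = opHead g (raise j j' (g.tgt ++ r) f) s := by
  have hjj : j ≠ j' := by rintro rfl; omega
  have h1 := hq
  have h2 := kw_mul j j'
  rcases g with (_ | _) | (_ | _) | e
  · change raise j j' r (fun s => ∑ c, f (c :: c :: s)) s =
      ∑ c, raise j j' (.up :: .down :: r) f (c :: c :: s)
    have := raise_sum j j' r Finset.univ (fun (c : Fin N) t => f (c :: c :: t)) (fun _ => 1) s
    simp only [one_mul] at this
    rw [this]
    simp only [raise, mul_add, Finset.sum_add_distrib, ← mul_assoc, h2, one_mul, mul_ite, mul_zero,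
      Finset.sum_ite_eq', Finset.mem_univ, if_true]
    simp only [kw, hjj.symm, if_true, if_false]
    linear_combination (f (j' :: j :: s)) * h1
  · change raise j j' r (fun s => ∑ c, cupWeight c * f (c :: c :: s)) s =
      ∑ c, cupWeight c * raise j j' (.down :: .up :: r) f (c :: c :: s)
    have := raise_sum j j' r Finset.univ (fun (c : Fin N) t => f (c :: c :: t)) cupWeight s
    rw [this]
    simp only [raise, mul_add, Finset.sum_add_distrib, mul_ite, mul_zero,
      Finset.sum_ite_eq', Finset.mem_univ, if_true]
    have h3 : ∀ c x, cupWeight c * (kw' j j' c * (kw j j' c * x)) = cupWeight c * x := fun c x => by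
      linear_combination cupWeight c * x * h2 c
    have h4 : kw' j j' j = T 1 := by simp [kw']
    simp only [h3, h4]
    linear_combination (f (j :: j' :: s)) * wtInv_succ hj
  · match s with
    | [] => simp [Piece.src] at hs; omega
    | [_] => simp [Piece.src] at hs; omega
    | a :: b :: s =>
    have h3 := wt_succ hj
    change raise j j' (.up :: .down :: r) (opHead (.cap .up) f) (a :: b :: s) =
      if a = b then capWeight a * raise j j' r f s else 0
    simp only [raise, opHead]
    by_cases hab : a = b
    · subst hab
      simp only [if_true, raise_smul]
      have := h2 a
      grind
    · simp only [hab, if_false, raise_zero, mul_zero, add_zero]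
      by_cases ha : a = j
      · subst ha
        by_cases hb : b = j'
        · subst hb
          simp only [if_true, kw]
          linear_combination f s * h3
        · simp [hb, Ne.symm hb]
      · by_cases hb : b = j'
        · simp [ha, hb]
        · simp [ha, hb]
  · match s with
    | [] => simp [Piece.src] at hs; omega
    | [_] => simp [Piece.src] at hs; omega
    | a :: b :: s =>
    change raise j j' (.down :: .up :: r) (opHead (.cap .down) f) (a :: b :: s) =
      if a = b then raise j j' r f s else 0
    simp only [raise, opHead]
    by_cases hab : a = b
    · subst hab
      simp only [if_true]
      have := h2 a
      grind
    · simp only [hab, if_false, raise_zero, mul_zero, add_zero]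
      by_cases ha : a = j'
      · subst ha
        by_cases hb : b = j
        · subst hb
          simp only [if_true, kw', hjj.symm, if_false]
          ring
        · simp [hb, Ne.symm hb]
      · by_cases hb : b = j
        · simp [ha, hb]
        · simp [ha, hb]
  · match s with
    | [] => simp [Piece.src] at hs; omega
    | [_] => simp [Piece.src] at hs; omega
    | a :: b :: s => exact raise_cross j j' hj e f a b s r

theorem raise_opAt (j j' : Fin N) (hj : (j' : ℕ) = j + 1) (g : Piece) (l r : List Dir) (f : Fn N) (s)
    (hs : s.length = l.length + g.src.length + r.length) :
    raise j j' (l ++ g.src ++ r) (opAt l.length g f) s =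
      opAt l.length g (raise j j' (l ++ g.tgt ++ r) f) s := by
  induction l generalizing f s with
  | nil => exact raise_opHead j j' hj g r f s (by simpa using hs)
  | cons d l ih =>
    cases s with
    | nil => simp at hs; omega
    | cons a s =>
      have ih := ih (fun t => f (a :: t)) s (by simp at hs; omega)
      cases d <;>
        simp only [List.cons_append, raise, opAt, List.length_cons, opAt_add, opAt_smul, ih] <;>
        split_ifs <;> simp only [opAt_smul, opAt_zero]

theorem raise_op (j j' : Fin N) (hj : (j' : ℕ) = j + 1) (w : Word) (o o' : List Dir)
    (hw : Path w o o') (f : Fn N) (s : List (Fin N)) (hs : s.length = o.length) :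
    raise j j' o (op w f) s = op w (raise j j' o' f) s := by
  induction w generalizing o s with
  | nil => cases hw; rfl
  | cons x w ih =>
    obtain ⟨o₁, ⟨l, r, hl, rfl, rfl⟩, h₂⟩ := hw
    simp only [op, ← hl]
    rw [raise_opAt j j' hj _ _ _ _ _ (by simp [hs, add_assoc])]
    refine opAt_congr _ _ r.length _ _ (fun t ht => ?_) s (by simp [hs, add_assoc])
    exact ih _ h₂ t (by simp [ht, add_assoc])

theorem functional_const (d : Dir) (w : Word) (h : Path w [d, d.rev] []) (z : Fin N) (hz : (z : ℕ) = 0)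
    (c : Fin N) :
    op w (fun _ => 1) [c, c] = (match d with
      | .up => T (-2 * (c : ℤ))
      | .down => 1) * op w (fun _ => 1) [z, z] := by
  obtain ⟨c, hc⟩ := c
  induction c with
  | zero =>
    obtain rfl : z = ⟨0, hc⟩ := Fin.ext hz
    cases d <;> simp
  | succ c ih =>
    have ih := ih (by omega)
    have h1 := hq
    set j : Fin N := ⟨c, by omega⟩
    set j' : Fin N := ⟨c + 1, hc⟩
    have hjj : j ≠ j' := by simp [j, j']
    have hj : (j' : ℕ) = j + 1 := rfl
    have h0 : ∀ s, s.length = 2 → raise j j' [d, d.rev] (op w fun _ => 1) s = 0 := fun s hs => by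
      rw [raise_op j j' hj w _ _ h _ _ (by simp [hs])]
      have : (raise j j' [] fun _ => 1) = fun _ => (0 : ℤ[T;T⁻¹]) := rfl
      rw [this, op_congr w _ _ h _ (fun t => 0 * (1 : ℤ[T;T⁻¹])) (by simp) s hs]
      clear * -
      induction w generalizing s with
      | nil => simp [op]
      | cons x w ih =>
        have : op (N := N) w (fun t => 0 * (1 : ℤ[T;T⁻¹])) = fun _ => 0 := funext ih
        simp only [op, this, opAt_zero]
    cases d with
    | up =>
      have := h0 [j, j'] rfl
      simp only [raise, Dir.rev, if_true, kw, mul_zero, add_zero] at this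
      have h2 : (T (-2 * ((c + 1 : ℕ) : ℤ)) : ℤ[T;T⁻¹]) = T (-1) * T (-1) * T (-2 * (c : ℤ)) := by
        simp only [← LaurentPolynomial.T_add]; push_cast; ring_nf
      simp only [j'] at this ⊢
      rw [h2]
      linear_combination this + T (-1) * T (-1) * ih
    | down =>
      have := h0 [j', j] rfl
      simp only [raise, Dir.rev, if_true, kw', mul_zero, add_zero, hjj.symm, if_false] at this
      linear_combination T 1 * this + ih + (op w (fun _ => 1) [j, j] - op w (fun _ => 1) [j', j']) * h1

theorem sum_wt : ∑ c : Fin N, capWeight c = quantumInt N := by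
  simp only [capWeight, quantumInt]
  exact Fin.sum_univ_eq_sum_range (fun k => (T ((N : ℤ) - 1 - 2 * k) : ℤ[T;T⁻¹])) N

theorem sum_wtInv : ∑ c : Fin N, cupWeight c = quantumInt N := by
  simp only [cupWeight, quantumInt]
  rw [Fin.sum_univ_eq_sum_range (fun k => (T (-((N : ℤ) - 1 - 2 * k)) : ℤ[T;T⁻¹])) N,
    ← Finset.sum_range_reflect]
  refine Finset.sum_congr rfl fun k hk => ?_
  have := Finset.mem_range.1 hk
  congr 1
  omega

theorem wt_eq (c : Fin N) : T (-2 * (c : ℤ)) = T (1 - (N : ℤ)) * capWeight c := by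
  rw [capWeight, ← LaurentPolynomial.T_add]
  congr 1; ring

theorem stateSum_dvd (D : Diagram) : quantumInt N ∣ stateSum N D := by
  obtain ⟨w, hw, h⟩ := D
  match w, hw, h with
  | (i, g) :: w, _, ⟨o, ⟨l, r, hl, h1, h2⟩, h3⟩ =>
    obtain ⟨h4, rfl⟩ := List.append_eq_nil_iff.1 h1.symm
    obtain ⟨rfl, hg⟩ := List.append_eq_nil_iff.1 h4
    obtain rfl : 0 = i := hl
    rcases g with d | d | e
    · have h3 : Path w [d, d.rev] [] := by subst h2; exact h3
      rcases Nat.eq_zero_or_pos N with rfl | hN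
      · cases d <;> simp [stateSum, op, opAt, opHead, quantumInt]
      · have h4 := functional_const (N := N) d w h3 ⟨0, hN⟩ rfl
        cases d
        · simp only [stateSum, op, opAt, opHead]
          rw [Finset.sum_congr rfl fun c _ => h4 c]
          simp only [wt_eq]
          rw [← Finset.sum_mul, ← Finset.mul_sum, sum_wt, mul_comm (T _), mul_assoc]
          exact dvd_mul_right _ _
        · simp only [stateSum, op, opAt, opHead]
          rw [Finset.sum_congr rfl fun c _ => congrArg (cupWeight c * ·) (h4 c)]
          simp only [one_mul]
          rw [← Finset.sum_mul, sum_wtInv]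
          exact dvd_mul_right _ _
    · exact absurd hg (List.cons_ne_nil _ _)
    · exact absurd hg (List.cons_ne_nil _ _)

theorem quantumInt_ne_zero (h : N ≠ 0) : quantumInt N ≠ 0 := by
  intro h0
  have := congrArg (LaurentPolynomial.eval₂ (RingHom.id ℤ) (1 : ℤˣ)) h0
  simp [quantumInt, h] at this

/-- The state sum of a link. -/
noncomputable def Link.stateSum (N : ℕ) : Link → ℤ[T;T⁻¹] :=
  Quot.lift (OrientedLink.stateSum N) stateSum_rel

theorem Link.stateSum_dvd (L : Link) : quantumInt N ∣ L.stateSum N :=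
  Quot.ind (β := fun L => quantumInt N ∣ Link.stateSum N L) OrientedLink.stateSum_dvd L

variable (N) in
/-- For `N ≥ 1`, the link invariant `V_N`, defined by `[N] * V_N(L) = stateSum N L`. It is the
invariant with value `1` on the trivial knot that satisfies the skein relation
`q^(-N) V_N(L₊) - q^N V_N(L₋) = (q⁻¹ - q) V_N(L₀)`, see `V_unknot` and `V_skein`. -/
noncomputable def V (L : Link) : ℤ[T;T⁻¹] := (L.stateSum_dvd (N := N)).choose

theorem V_spec (D : Diagram) : quantumInt N * V N D.link = stateSum N D :=
  (D.link.stateSum_dvd (N := N)).choose_spec.symm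

/-- The round circle. -/
def unknot : Diagram where
  word := [(0, .cup .up), (0, .cap .up)]
  ne_nil := by simp
  closed := ⟨_, ⟨[], [], rfl, rfl, rfl⟩, _, ⟨[], [], rfl, rfl, rfl⟩, rfl⟩

theorem V_unknot (h : N ≠ 0) : V N unknot.link = 1 := by
  refine mul_left_cancel₀ (quantumInt_ne_zero h) ?_
  rw [V_spec, mul_one]
  simp [stateSum, unknot, op, opAt, opHead, sum_wt]

theorem opAt_skein (i : ℕ) (f : Fn N) : ∀ s, i + 2 ≤ s.length →
    T (-N) * opAt i (.cross true) f s - T N * opAt i (.cross false) f s =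
      (T (-1) - T 1) * f s := by
  induction i generalizing f with
  | zero =>
    rintro (_ | ⟨a, _ | ⟨b, s⟩⟩) hs
    · simp at hs
    · simp at hs
    have h1 := hq
    have h2 := hQ (N := N)
    simp only [opAt, opHead, diagWeight, swapWeight]
    generalize (T 1 : ℤ[T;T⁻¹]) = q at *
    generalize (T (-1) : ℤ[T;T⁻¹]) = q' at *
    generalize (T N : ℤ[T;T⁻¹]) = Q at *
    generalize (T (-N) : ℤ[T;T⁻¹]) = Q' at *
    rcases lt_trichotomy a b with h | h | h
    · simp only [h, h.ne, h.not_gt, if_true, if_false]; grind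
    · subst h; simp only [if_true]; grind
    · simp only [h, h.ne', h.not_gt, if_true, if_false]; grind
  | succ i ih =>
    rintro (_ | ⟨a, s⟩) hs
    · simp at hs
    · exact ih (fun t => f (a :: t)) s (by simp at hs; omega)

theorem op_sub (u : Word) (f f' g : Fn N) (o o' : List Dir) (hu : Path u o o') (a b c : ℤ[T;T⁻¹])
    (h : ∀ s, s.length = o'.length → a * f s - b * f' s = c * g s) (s) (hs : s.length = o.length) :
    a * op u f s - b * op u f' s = c * op u g s := by
  induction u generalizing o s with
  | nil => cases hu; exact h s hs
  | cons x u ih =>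
    obtain ⟨o₁, h₁, h₂⟩ := hu
    obtain ⟨r, hr, hr'⟩ := step_length h₁
    have h3 := opAt_congr x.1 x.2 r (fun t => a * op u f t + (-b) * op u f' t)
      (fun t => c * op u g t) (fun t ht => by
        rw [← ih o₁ h₂ t (ht.trans hr'.symm)]; ring) s (hs.trans hr)
    simp only [opAt_add, opAt_smul] at h3
    simp only [op]
    rw [← h3]; ring

/-- The skein relation of `V_N`. -/
theorem V_skein (h : N ≠ 0) (Dp Dm D0 : Diagram) (u v : Word) (i : ℕ)
    (hp : Dp.word = u ++ (i, .cross true) :: v) (hm : Dm.word = u ++ (i, .cross false) :: v)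
    (h0 : D0.word = u ++ v) :
    T (-N) * V N Dp.link - T N * V N Dm.link =
      (T (-1) - T 1) * V N D0.link := by
  refine mul_left_cancel₀ (quantumInt_ne_zero h) ?_
  have hc := Dp.closed
  rw [hp] at hc
  obtain ⟨o, hu, o', hs, -⟩ := path_append hc
  obtain ⟨r, hr, -⟩ := step_length hs
  have := op_sub u (op ((i, .cross true) :: v) fun _ => 1) (op ((i, .cross false) :: v) fun _ => 1)
    (op v fun _ => 1) [] o hu (T (-N)) (T N) (T (-1) - T 1)
    (fun s hs => opAt_skein i _ s (by simp [Piece.src] at hr; omega)) [] rfl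
  simp only [← op_append, ← hp, ← hm, ← h0] at this
  simp only [← stateSum.eq_1, ← V_spec] at this
  linear_combination this

end StateSum

/-- The nullity of an integral Laurent polynomial `P` at a nonzero complex number `z`: the
multiplicity of the root `z`, that is, the largest `ν` such that `(q - z) ^ ν` divides `P` in
`ℂ[q, q⁻¹]`. It is `⊤` for `P = 0`. -/
noncomputable def nullity (z : ℂ) (P : ℤ[T;T⁻¹]) : ℕ∞ :=
  emultiplicity (T 1 - LaurentPolynomial.C z : ℂ[T;T⁻¹])
    (AddMonoidAlgebra.mapRingHom ℤ (Int.castRingHom ℂ) P)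

/-- The value of an integral Laurent polynomial at `q = 1`. -/
noncomputable def evalOne : ℤ[T;T⁻¹] →+* ℤ := LaurentPolynomial.eval₂ (RingHom.id ℤ) 1

end OrientedLink

namespace OrientedLink

/-! ### The state sum at `q = 1` -/

section EvalOne
variable {N : ℕ}

/-! Two facts about `V N L` carry the proof: its value at `q = 1`, and, for odd `N`, its invariance
under `q ↦ -q`.

Value at `q = 1`. All cup and cap weights become `1` on equal colours, and the `R`-matrix becomes
the flip of two strands. The state sum then counts the colourings that are constant along each
circle of the diagram, which gives `N ^ n` (`evalOne_stateSum`). Dividing by `[N]`, whose value is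
`N`, leaves `N ^ (n - 1)`. Consequently `[N] ^ ν ∣ V N L` forces `N ^ ν ∣ N ^ (n - 1)`, so the
multiplicity `μ` of `[N]` is finite and at most `n - 1`.

Nullity. Write `V N L = [N] ^ μ * R` with `[N] ∤ R`. Up to a power of `q`, `[N]` is `Φ_N(q²)`, a
divisor of the separable polynomial `q^(2N) - 1`, so `ω` is a simple root of it. The nullity is
therefore `μ` once `R(ω) ≠ 0` is known (`nullity_pow_mul`). For `N = 2` this is clear, because
`Φ_2(q²) = Φ_4` is the minimal polynomial of `ω`: a zero at `ω` would make `R` divisible by `[2]`.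
For odd `N`, however, `Φ_N(q²) = Φ_N Φ_{2N}`, and a zero at `ω` yields only one of the two factors.
The roots of these factors are exchanged by `q ↦ -q`, so the other factor follows if `R(-q) = R(q)`.

Symmetry. For odd `N` the substitution `q ↦ -q` fixes the cup and cap weights and the diagonal
entries at crossings, and negates the off-diagonal entries. Conjugation by the sign of the number of
inversions of a row of colours undoes this change (`negVar_op`) and is trivial on the empty row, so
state sums of closed diagrams are invariant. Hence so are `V N L` and, after cancelling `[N] ^ μ`,
also `R`. -/

theorem evalOne_T (n : ℤ) : evalOne (T n) = 1 := by
  simp [evalOne]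

theorem evalOne_quantumInt : evalOne (quantumInt N) = N := by
  simp [quantumInt, evalOne_T]

theorem evalOne_opAt_cup (i : ℕ) (d : Dir) (f : Fn N) (s : List (Fin N)) (hs : i ≤ s.length) :
    evalOne (opAt i (.cup d) f s) = ∑ c, evalOne (f (s.take i ++ c :: c :: s.drop i)) := by
  induction i generalizing f s with
  | zero => cases d <;> simp [opAt, opHead, evalOne_T, cupWeight]
  | succ i ih =>
    cases s with
    | nil => simp at hs
    | cons a s => exact ih (fun t => f (a :: t)) s (by simpa using hs)

theorem evalOne_opAt_cap (d : Dir) (f : Fn N) (l r : List (Fin N)) (a b : Fin N) :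
    evalOne (opAt l.length (.cap d) f (l ++ a :: b :: r)) =
      if a = b then evalOne (f (l ++ r)) else 0 := by
  induction l generalizing f with
  | nil => cases d <;> simp [opAt, opHead] <;> split_ifs <;> simp [evalOne_T, capWeight]
  | cons c l ih => exact ih (fun t => f (c :: t))

/-- The diagonal entries with `a ≠ b` are `0` or a multiple of `q - q⁻¹`, so they vanish at `q = 1`.
Both kinds of crossing become the flip, and the over/under information is lost. -/
theorem evalOne_opAt_cross (e : Bool) (f : Fn N) (l r : List (Fin N)) (a b : Fin N) :
    evalOne (opAt l.length (.cross e) f (l ++ a :: b :: r)) = evalOne (f (l ++ b :: a :: r)) := by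
  induction l generalizing f with
  | nil =>
    by_cases h : a = b
    · subst h
      cases e <;> simp only [List.length_nil, List.nil_append, opAt, opHead, diagWeight, swapWeight,
        if_true, map_add, map_mul, evalOne_T, map_zero] <;> ring
    · cases e <;> simp only [List.length_nil, List.nil_append, opAt, opHead, diagWeight, swapWeight,
        h, if_false, map_add, map_mul, evalOne_T, apply_ite evalOne, map_sub, map_zero, sub_self,
        ite_self] <;> ring
  | cons c l ih => exact ih (fun t => f (c :: t))

/-- Exchanging the entry `c k` with `z` is an involution on the pairs `(c, z)`. The lemma lets the
colour of a single arc be summed separately at the cost of a factor `card α`. -/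
theorem sum_sum_update {ι α M : Type*} [Fintype ι] [DecidableEq ι] [Fintype α] [AddCommMonoid M]
    (k : ι) (G : (ι → α) → M) :
    ∑ c : ι → α, ∑ z, G (Function.update c k z) = Fintype.card α • ∑ c, G c := by
  rw [← Finset.sum_product', Finset.univ_product_univ, ← Finset.card_univ, ← Finset.sum_const,
    Finset.sum_comm' (t' := Finset.univ) (s' := fun _ => Finset.univ) (by simp),
    ← Finset.sum_product', Finset.univ_product_univ]
  refine Finset.sum_nbij' (fun p => (Function.update p.1 k p.2, p.1 k))
    (fun p => (Function.update p.1 k p.2, p.1 k)) ?_ ?_ ?_ ?_ ?_ <;> simp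

/-- The sum over all colourings `c` of the arcs with the names `0, …, K`, where the names of the
strands are listed in `s`. -/
theorem sum_evalOne_op (K : ℕ) (w : Word) (o : List Dir) (h : Path w o []) (k : ℕ) (s : List ℕ)
    (hs : s.length = o.length) (hk : ∀ a ∈ s, a < k) (hK : k + w.length ≤ K) :
    (N : ℤ) ^ (s.length / 2) * ∑ c : Fin (K + 1) → Fin N,
      evalOne (op w (fun _ => 1) (s.map fun a => c (Fin.ofNat (K + 1) a))) =
    (N : ℤ) ^ (K + 1) * (N : ℤ) ^ circles k s w := by
  -- The bound `hK` leaves room for one fresh name per layer, so all names in use stay below `K` and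
  -- reduction modulo `K + 1` does not identify them.
  have hcast : ∀ {a b : ℕ}, a < K → b < K → a ≠ b → Fin.ofNat (K + 1) a ≠ Fin.ofNat (K + 1) b := by
    intro a b ha hb hab h
    have := congrArg Fin.val h
    simp only [Fin.val_ofNat] at this
    rw [Nat.mod_eq_of_lt (by omega), Nat.mod_eq_of_lt (by omega)] at this
    exact hab this
  -- The factor `N ^ (s.length / 2)` keeps the identity balanced. A cup raises it by one factor `N`
  -- and turns the colour of the fresh name, so far irrelevant, into a genuine summation variable. A
  -- cap lowers it by one factor `N`, which is regained either from the new circle or from the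
  -- elimination of one of the two merged names. For the empty word all `N ^ (K + 1)` colourings
  -- contribute `1`.
  induction w generalizing o k s with
  | nil =>
    cases h
    obtain rfl := List.length_eq_zero_iff.1 hs
    simp [op, circles]
  | cons x w ih =>
    obtain ⟨i, g⟩ := x
    obtain ⟨o₁, ⟨l, r, rfl, rfl, rfl⟩, h₂⟩ := h
    simp only [List.length_cons] at hK
    rcases g with d | d | e
    · simp only [Piece.src, Piece.tgt, List.append_nil, List.append_assoc, List.length_append,
        List.cons_append, List.nil_append] at hs h₂
      have h1 := ih _ h₂ (k + 1) (s.take l.length ++ k :: k :: s.drop l.length)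
        (by simp; omega) (by
          intro a ha
          simp only [List.mem_append, List.mem_cons] at ha
          rcases ha with ha | rfl | rfl | ha
          · exact (hk a (List.mem_of_mem_take ha)).trans (by omega)
          · omega
          · omega
          · exact (hk a (List.mem_of_mem_drop ha)).trans (by omega)) (by omega)
      have hlen : (s.take l.length ++ k :: k :: s.drop l.length).length / 2 = s.length / 2 + 1 := by
        simp; omega
      rw [hlen] at h1
      simp only [circles]
      rw [← h1, pow_succ, mul_assoc]
      congr 1
      -- The name `k` does not occur in `s`, so resetting `c k` to `z` changes only the two new
      -- strands, and the sum over `z` is the sum over the colour of the cup.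
      have h3 := sum_sum_update (Fin.ofNat (K + 1) k) fun c : Fin (K + 1) → Fin N =>
        evalOne (op w (fun _ => 1) ((s.take l.length ++ k :: k :: s.drop l.length).map
          fun a => c (Fin.ofNat (K + 1) a)))
      rw [Fintype.card_fin, nsmul_eq_mul] at h3
      rw [← h3]
      refine Finset.sum_congr rfl fun c _ => ?_
      simp only [op]
      rw [evalOne_opAt_cup _ _ _ _ (by simp; omega)]
      refine Finset.sum_congr rfl fun z _ => ?_
      have h4 : ∀ t : List ℕ, (∀ a ∈ t, a ∈ s) →
          t.map (fun a => Function.update c (Fin.ofNat (K + 1) k) z (Fin.ofNat (K + 1) a)) =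
          t.map (fun a => c (Fin.ofNat (K + 1) a)) := by
        intro t ht
        refine List.map_congr_left fun a ha => Function.update_of_ne ?_ _ _
        have := hk a (ht a ha)
        exact hcast (by omega) (by omega) (by omega)
      rw [List.map_append, List.map_cons, List.map_cons, h4 _ fun _ => List.mem_of_mem_take,
        h4 _ fun _ => List.mem_of_mem_drop, Function.update_self, List.map_take, List.map_drop]
    · simp only [Piece.src, Piece.tgt, List.append_nil, List.append_assoc, List.length_append,
        List.cons_append, List.nil_append, List.length_cons] at hs h₂
      obtain ⟨s₁, s₂, rfl, hs₁⟩ : ∃ s₁ s₂, s = s₁ ++ s₂ ∧ s₁.length = l.length :=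
        ⟨s.take l.length, s.drop l.length, by simp, by simp; omega⟩
      match s₂ with
      | [] => simp at hs; omega
      | [_] => simp at hs; omega
      | x :: y :: s₂ =>
      simp only [List.length_append, List.length_cons] at hs
      simp only [op, circles, ← hs₁, List.drop_left', List.take_left', List.map_append,
        List.map_cons]
      have h5 : ∀ c : Fin (K + 1) → Fin N, evalOne (opAt s₁.length (.cap d) (op w fun _ => 1)
          (s₁.map (fun a => c (Fin.ofNat (K + 1) a)) ++ c (Fin.ofNat (K + 1) x) ::
            c (Fin.ofNat (K + 1) y) :: s₂.map (fun a => c (Fin.ofNat (K + 1) a)))) =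
          if c (Fin.ofNat (K + 1) x) = c (Fin.ofNat (K + 1) y) then evalOne (op w (fun _ => 1)
            ((s₁ ++ s₂).map (fun a => c (Fin.ofNat (K + 1) a)))) else 0 := fun c => by
        rw [List.map_append, ← evalOne_opAt_cap d, List.length_map]
      have hlen : (s₁ ++ x :: y :: s₂).length / 2 = (s₁ ++ s₂).length / 2 + 1 := by
        simp; omega
      have hx : x < k := hk x (by simp)
      have hy : y < k := hk y (by simp)
      have hk' : ∀ a ∈ s₁ ++ s₂, a < k := fun a ha => hk a (by simp at ha ⊢; tauto)
      simp only [h5]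
      rw [hlen]
      split_ifs with hxy
      -- The cap closes a circle: its condition `c x = c x` is void.
      · subst hxy
        have h1 := ih _ h₂ k (s₁ ++ s₂) (by simp; omega) hk' (by omega)
        simp only [if_true]
        rw [pow_succ (N : ℤ) (circles _ _ _), pow_succ (N : ℤ) (_ / 2)]
        linear_combination (N : ℤ) * h1
      · have h1 := ih _ h₂ k ((s₁ ++ s₂).map fun z => if z = y then x else z) (by simp; omega)
          (by
            intro a ha
            obtain ⟨b, hb, rfl⟩ := List.mem_map.1 ha
            have := hk' b hb
            split_ifs <;> omega) (by omega)
        rw [List.length_map] at h1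
        rw [← List.map_append, ← h1, pow_succ, mul_assoc]
        congr 1
        -- The cap merges two arcs. Summing over the colour of `y` separately, the condition at the
        -- cap selects the value `c x`, which amounts to renaming `y` to `x` in the remaining
        -- strands.
        have h3 := sum_sum_update (Fin.ofNat (K + 1) y) fun c : Fin (K + 1) → Fin N =>
          if c (Fin.ofNat (K + 1) x) = c (Fin.ofNat (K + 1) y) then evalOne (op w (fun _ => 1)
            ((s₁ ++ s₂).map (fun a => c (Fin.ofNat (K + 1) a)))) else 0
        rw [Fintype.card_fin, nsmul_eq_mul] at h3
        rw [← h3]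
        refine Finset.sum_congr rfl fun c _ => ?_
        simp only [Function.update_self, Function.update_of_ne (hcast (a := x) (b := y)
          (by omega) (by omega) hxy), Finset.sum_ite_eq, Finset.mem_univ, if_true]
        rw [List.map_map]
        congr 2
        refine List.map_congr_left fun a ha => ?_
        have := hk' a ha
        simp only [Function.comp]
        split_ifs with hay
        · subst hay; rw [Function.update_self]
        · exact Function.update_of_ne (hcast (by omega) (by omega) hay) _ _
    · simp only [Piece.src, Piece.tgt, List.append_assoc, List.length_append,
        List.cons_append, List.nil_append, List.length_cons] at hs h₂
      obtain ⟨s₁, s₂, rfl, hs₁⟩ : ∃ s₁ s₂, s = s₁ ++ s₂ ∧ s₁.length = l.length :=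
        ⟨s.take l.length, s.drop l.length, by simp, by simp; omega⟩
      match s₂ with
      | [] => simp at hs; omega
      | [_] => simp at hs; omega
      | x :: y :: s₂ =>
      simp only [List.length_append, List.length_cons] at hs
      have h1 := ih _ h₂ k (s₁ ++ y :: x :: s₂) (by simp; omega)
        (fun a ha => hk a (by simp at ha ⊢; tauto)) (by omega)
      simp only [circles, ← hs₁, List.drop_left', List.take_left']
      rw [← h1]
      congr 1
      · simp
      · refine Finset.sum_congr rfl fun c _ => ?_
        simp only [op, List.map_append, List.map_cons]
        have h3 := evalOne_opAt_cross e (op w fun _ => 1)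
          (s₁.map fun a => c (Fin.ofNat (K + 1) a)) (s₂.map fun a => c (Fin.ofNat (K + 1) a))
          (c (Fin.ofNat (K + 1) x)) (c (Fin.ofNat (K + 1) y))
        rwa [List.length_map] at h3

theorem evalOne_stateSum (hN : N ≠ 0) (D : Diagram) :
    evalOne (stateSum N D) = (N : ℤ) ^ D.components := by
  have h := sum_evalOne_op (N := N) D.word.length D.word [] D.closed 0 [] rfl (by simp) (by simp)
  -- With no strands the summand does not depend on the colouring, so both sides carry the factor `N
  -- ^ (K + 1)`, where `K` is the number of layers.
  simp only [List.map_nil, Finset.sum_const, Finset.card_univ, Fintype.card_pi, Fintype.card_fin,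
    Finset.prod_const, List.length_nil, Nat.zero_div, pow_zero, one_mul, nsmul_eq_mul] at h
  push_cast at h
  exact mul_left_cancel₀ (pow_ne_zero _ (by exact_mod_cast hN)) h

theorem Link.HasComponents.evalOne_V {L : Link} {n : ℕ} (h : L.HasComponents n) (hN : N ≠ 0) :
    N * evalOne (V N L) = (N : ℤ) ^ n := by
  obtain ⟨D, rfl, rfl⟩ := h
  rw [← evalOne_stateSum hN, ← V_spec, map_mul, evalOne_quantumInt]

/-- Without components the identity at `N = 2` would read `2 * x = 1` in `ℤ`. This makes the
truncated subtraction `n - 1` an honest one. -/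
theorem Link.HasComponents.one_le {L : Link} {n : ℕ} (h : L.HasComponents n) : 1 ≤ n := by
  have := h.evalOne_V (N := 2) (by simp)
  by_contra! hn
  obtain rfl : n = 0 := by omega
  simp at this
  omega

theorem Link.HasComponents.evalOne_V_eq {L : Link} {n : ℕ} (h : L.HasComponents n) (hN : N ≠ 0) :
    evalOne (V N L) = (N : ℤ) ^ (n - 1) := by
  refine mul_left_cancel₀ (show (N : ℤ) ≠ 0 by exact_mod_cast hN) ?_
  rw [h.evalOne_V hN, ← pow_succ', Nat.sub_add_cancel h.one_le]

end EvalOne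

/-! ### Parity of the exponents for odd `N` -/

section Parity
variable {N : ℕ}

/-- The substitution `q ↦ -q`. -/
noncomputable def negVar : ℤ[T;T⁻¹] →+* ℤ[T;T⁻¹] :=
  LaurentPolynomial.eval₂ LaurentPolynomial.C
    (-(LaurentPolynomial.isUnit_T 1 : IsUnit (T 1 : ℤ[T;T⁻¹])).unit)

theorem val_unit_T_zpow (n : ℤ) :
    (((LaurentPolynomial.isUnit_T 1 : IsUnit (T 1 : ℤ[T;T⁻¹])).unit ^ n : (ℤ[T;T⁻¹])ˣ) : ℤ[T;T⁻¹])
      = T n := by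
  induction n with
  | zero => simp
  | succ n ih => rw [zpow_add_one, Units.val_mul, ih, LaurentPolynomial.T_add]; rfl
  | pred n ih =>
    refine (LaurentPolynomial.isUnit_T 1).mul_right_cancel ?_
    rw [← LaurentPolynomial.T_add, sub_add_cancel, ← ih, zpow_sub_one, Units.val_mul, mul_assoc]
    simp

theorem negVar_T_of_even {n : ℤ} (h : Even n) : negVar (T n) = T n := by
  rw [negVar, LaurentPolynomial.eval₂_T, h.neg_zpow, val_unit_T_zpow]

theorem negVar_T_of_odd {n : ℤ} (h : Odd n) : negVar (T n) = -T n := by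
  rw [negVar, LaurentPolynomial.eval₂_T, h.neg_zpow, Units.val_neg, val_unit_T_zpow]

/-! ### Gauge signs and the symmetry of the state sum under `q ↦ -q` -/

/-- A sign for every row of colours which is unchanged if a pair of equal adjacent colours is
inserted, and which changes if two different adjacent colours are swapped. -/
structure IsGauge (ε : Fn N) : Prop where
  mul_self : ∀ s, ε s * ε s = 1
  insert : ∀ l r c, ε (l ++ c :: c :: r) = ε (l ++ r)
  swap : ∀ l r a b, a ≠ b → ε (l ++ b :: a :: r) = -ε (l ++ a :: b :: r)

/-- This allows induction on the number of strands to the left of a piece. A normalisation `ε [] =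
1` would not survive fixing the leftmost colours, which is why `IsGauge` does not require it. -/
theorem IsGauge.cons {ε : Fn N} (h : IsGauge ε) (c : Fin N) : IsGauge fun s => ε (c :: s) where
  mul_self _ := h.mul_self _
  insert l := h.insert (c :: l)
  swap l := h.swap (c :: l)

/-- The sign of the number of inversions. -/
noncomputable def inversionSign : Fn N
  | [] => 1
  | a :: s => (-1) ^ s.countP (· < a) * inversionSign s

/-- An inserted pair `c, c` forms no inversion in itself, and its two members have the same
inversions with every other colour, so the count changes by an even number. Swapping two different
neighbours changes only the inversion between them. -/
theorem isGauge_inversionSign : IsGauge (inversionSign (N := N)) where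
  mul_self s := by
    induction s with
    | nil => simp [inversionSign]
    | cons a s ih =>
      rw [inversionSign, mul_mul_mul_comm, ih, ← mul_pow]
      simp
  insert l r c := by
    induction l with
    | nil =>
      simp only [List.nil_append, inversionSign, List.countP_cons, lt_irrefl, decide_false,
        Bool.false_eq_true, if_false, add_zero]
      rw [← mul_assoc, ← mul_pow]
      simp
    | cons a l ih =>
      simp only [List.cons_append, inversionSign, ih, List.countP_append, List.countP_cons]
      congr 1
      split_ifs
      · rw [show l.countP (· < a) + (r.countP (· < a) + 1 + 1) =
          l.countP (· < a) + r.countP (· < a) + 2 by ring, pow_add _ _ 2]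
        simp
      · simp
  swap l r a b h := by
    induction l with
    | nil =>
      simp only [List.nil_append, inversionSign, List.countP_cons]
      rcases lt_or_gt_of_ne h with h | h <;> simp [h, h.not_gt, pow_succ] <;> ring
    | cons c l ih =>
      simp only [List.cons_append, inversionSign, ih, List.countP_append, List.countP_cons]
      rw [mul_neg]
      congr 3
      ring

theorem negVar_capWeight (hN : Odd N) (a : Fin N) : negVar (capWeight a) = capWeight a := by
  refine negVar_T_of_even ?_
  obtain ⟨m, rfl⟩ := hN
  exact ⟨m - a, by push_cast; ring⟩

theorem negVar_cupWeight (hN : Odd N) (a : Fin N) : negVar (cupWeight a) = cupWeight a := by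
  refine negVar_T_of_even ?_
  obtain ⟨m, rfl⟩ := hN
  exact ⟨a - m, by push_cast; ring⟩

/-- The off-diagonal entries are odd powers `q ^ (±N)`, whereas the diagonal entries carry a further
factor with odd exponents and are even. The resulting relative sign is exactly that in
`IsGauge.swap`. -/
theorem negVar_swapWeight (hN : Odd N) (e : Bool) (a b : Fin N) :
    negVar (swapWeight e a b) = -swapWeight e a b := by
  have h : Odd (N : ℤ) := by exact_mod_cast hN
  cases e <;> simp only [swapWeight] <;> split_ifs <;>
    simp [negVar_T_of_odd h, negVar_T_of_odd h.neg]

theorem negVar_diagWeight (hN : Odd N) (e : Bool) (a b : Fin N) :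
    negVar (diagWeight e a b) = diagWeight e a b := by
  have h : Odd (N : ℤ) := by exact_mod_cast hN
  have h1 : negVar (T 1) = -T 1 := negVar_T_of_odd (by decide)
  have h2 : negVar (T (-1)) = -T (-1) := negVar_T_of_odd (by decide)
  cases e <;> simp only [diagWeight, map_mul] <;> split_ifs <;>
    simp only [negVar_T_of_odd h, negVar_T_of_odd h.neg, h1, h2, map_sub, map_zero] <;> ring

/-- Conjugation by `ε` is the identity on cups and caps, which insert or remove a pair of equal
colours. At a crossing it negates the off-diagonal entries and keeps the diagonal ones, as does `q ↦
-q`. -/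
theorem negVar_opAt (hN : Odd N) (i : ℕ) (g : Piece) {ε : Fn N} (hε : IsGauge ε) (f : Fn N) (s) :
    negVar (opAt i g f s) = ε s * opAt i g (fun t => ε t * negVar (f t)) s := by
  induction i generalizing f s ε with
  | zero =>
    rcases g with (_ | _) | (_ | _) | e
    · simp only [opAt, opHead, map_sum, Finset.mul_sum]
      refine Finset.sum_congr rfl fun c _ => ?_
      have hi : ε (c :: c :: s) = ε s := hε.insert [] s c
      linear_combination -negVar (f (c :: c :: s)) * (hε.mul_self s + ε s * hi)
    · simp only [opAt, opHead, map_sum, Finset.mul_sum, map_mul, negVar_cupWeight hN]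
      refine Finset.sum_congr rfl fun c _ => ?_
      have hi : ε (c :: c :: s) = ε s := hε.insert [] s c
      linear_combination -cupWeight c * negVar (f (c :: c :: s)) *
        (hε.mul_self s + ε s * hi)
    all_goals
      match s with
      | [] => simp [opAt, opHead]
      | [_] => simp [opAt, opHead]
      | a :: b :: s => ?_
    · simp only [opAt, opHead]
      split_ifs with h
      · subst h
        have hi : ε (a :: a :: s) = ε s := hε.insert [] s a
        rw [map_mul, negVar_capWeight hN]
        linear_combination -capWeight a * negVar (f s) * (hε.mul_self s + ε s * hi)
      · simp
    · simp only [opAt, opHead]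
      split_ifs with h
      · subst h
        have hi : ε (a :: a :: s) = ε s := hε.insert [] s a
        linear_combination -negVar (f s) * (hε.mul_self s + ε s * hi)
      · simp
    · simp only [opAt, opHead, map_add, map_mul, negVar_diagWeight hN, negVar_swapWeight hN]
      have h1 := hε.mul_self (a :: b :: s)
      by_cases h : a = b
      · subst h
        rw [crP_self]
        linear_combination -diagWeight e a a * negVar (f (a :: a :: s)) * h1
      · have h2 := hε.swap [] s a b h
        simp only [List.nil_append] at h2
        rw [h2]
        linear_combination (-diagWeight e a b * negVar (f (a :: b :: s)) +
          swapWeight e a b * negVar (f (b :: a :: s))) * h1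
  | succ i ih =>
    cases s with
    | nil => simp [opAt]
    | cons a s => exact ih (hε.cons a) (fun t => f (a :: t)) s

theorem negVar_op (hN : Odd N) {ε : Fn N} (hε : IsGauge ε) (w : Word) (f : Fn N) (s) :
    negVar (op w f s) = ε s * op w (fun t => ε t * negVar (f t)) s := by
  induction w generalizing s with
  | nil => rw [op, op, ← mul_assoc, hε.mul_self, one_mul]
  | cons x w ih =>
    simp only [op]
    rw [negVar_opAt hN _ _ hε]
    simp only [ih, ← mul_assoc, hε.mul_self, one_mul]

theorem negVar_stateSum (hN : Odd N) (D : Diagram) : negVar (stateSum N D) = stateSum N D := by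
  rw [stateSum, negVar_op hN isGauge_inversionSign]
  -- A closed diagram begins and ends with the empty row, on which the gauge sign is `1`.
  rw [op_congr D.word _ _ D.closed _ (fun _ => 1) ?_ [] rfl]
  · simp [inversionSign]
  · rintro t ht
    obtain rfl := List.length_eq_zero_iff.1 ht
    simp [inversionSign]

theorem negVar_quantumInt (hN : Odd N) : negVar (quantumInt N) = quantumInt N := by
  rw [← sum_wt, map_sum]
  simp only [negVar_capWeight hN]

/-- For odd `N` only even powers of `q` occur in `V_N(L)`. -/
theorem negVar_V (hN : Odd N) (L : Link) : negVar (V N L) = V N L := by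
  induction L using Quot.ind with
  | mk D =>
  change negVar (V N D.link) = V N D.link
  refine mul_left_cancel₀ (quantumInt_ne_zero hN.pos.ne') ?_
  conv_lhs => rw [← negVar_quantumInt hN]
  rw [← map_mul, V_spec, negVar_stateSum hN]

end Parity

end OrientedLink
namespace OrientedLink

/-! ### Nullities and the factor `[N]` -/

section Nullity

/-- The value of an integral Laurent polynomial at a nonzero complex number. -/
noncomputable def evalAt (z : ℂˣ) : ℤ[T;T⁻¹] →+* ℂ := LaurentPolynomial.eval₂ (Int.castRingHom ℂ) z

theorem mapRingHom_T (n : ℤ) :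
    AddMonoidAlgebra.mapRingHom ℤ (Int.castRingHom ℂ) (T n) = T n :=
  (AddMonoidAlgebra.map_single ..).trans (congrArg (AddMonoidAlgebra.single n) Int.cast_one)

theorem mapRingHom_toLaurent (p : Polynomial ℤ) :
    AddMonoidAlgebra.mapRingHom ℤ (Int.castRingHom ℂ) p.toLaurent =
      (p.map (Int.castRingHom ℂ)).toLaurent := by
  induction p using Polynomial.induction_on' with
  | add p q hp hq => simp only [map_add, hp, hq, Polynomial.map_add]
  | monomial n a =>
    rw [← Polynomial.C_mul_X_pow_eq_monomial]
    simp [mapRingHom_T]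

theorem eval₂_mapRingHom (z : ℂˣ) (P : ℤ[T;T⁻¹]) :
    LaurentPolynomial.eval₂ (RingHom.id ℂ) z
      (AddMonoidAlgebra.mapRingHom ℤ (Int.castRingHom ℂ) P) = evalAt z P := by
  induction P using LaurentPolynomial.induction_on' with
  | add p q hp hq => simp only [map_add, hp, hq]
  | C_mul_T n a => simp [evalAt, mapRingHom_T]

theorem evalAt_negVar (z : ℂˣ) (P : ℤ[T;T⁻¹]) : evalAt z (negVar P) = evalAt (-z) P := by
  induction P using LaurentPolynomial.induction_on' with
  | add p q hp hq => simp only [map_add, hp, hq]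
  | C_mul_T n a =>
    rcases Int.even_or_odd n with h | h
    · simp [negVar_T_of_even h, evalAt, h.neg_zpow]
    · simp [negVar_T_of_odd h, evalAt, h.neg_zpow]

/-- If `A` has a simple root at `z` and `R` does not vanish there, then `A ^ μ * R` has a root of
multiplicity `μ`. -/
theorem nullity_pow_mul (z : ℂˣ) {A R : ℤ[T;T⁻¹]} {B : ℂ[T;T⁻¹]} (μ : ℕ)
    (hA : AddMonoidAlgebra.mapRingHom ℤ (Int.castRingHom ℂ) A =
      (T 1 - LaurentPolynomial.C (z : ℂ)) * B)
    (hB : LaurentPolynomial.eval₂ (RingHom.id ℂ) z B ≠ 0) (hR : evalAt z R ≠ 0) :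
    nullity z (A ^ μ * R) = μ := by
  have h0 : (T 1 - LaurentPolynomial.C (z : ℂ) : ℂ[T;T⁻¹]) ≠ 0 := by
    intro h
    have := congrArg Polynomial.degree (Polynomial.toLaurent_injective
      (a₁ := Polynomial.X - Polynomial.C (z : ℂ)) (a₂ := 0) (by simpa using h))
    simp at this
  rw [nullity, map_mul, map_pow, hA, mul_pow, mul_assoc]
  refine emultiplicity_eq_coe.2 ⟨dvd_mul_right _ _, ?_⟩
  -- If one more factor `q - z` divided the product, cancelling `(q - z) ^ μ` and evaluating at `z`
  -- would give `B(z) ^ μ * R(z) = 0`.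
  rintro ⟨S, hS⟩
  rw [pow_succ, mul_assoc] at hS
  have := congrArg (LaurentPolynomial.eval₂ (RingHom.id ℂ) z)
    (mul_left_cancel₀ (pow_ne_zero μ h0) hS)
  simp only [map_mul, map_pow, map_sub, LaurentPolynomial.eval₂_C, LaurentPolynomial.eval₂_T,
    eval₂_mapRingHom] at this
  simp [hB, hR] at this

/-! ### The cyclotomic factors of `[N]` and its complex roots -/

variable {N : ℕ}

/-- For prime `N`, `Φ_N(x) = 1 + x + ⋯ + x^(N-1)`; put `x = q²`. Up to a unit, questions about `[N]`
become questions about a polynomial in `ℤ[q]`. -/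
theorem quantumInt_eq (hN : N.Prime) :
    quantumInt N = T (1 - (N : ℤ)) *
      ((Polynomial.expand ℤ 2 (Polynomial.cyclotomic N ℤ)).toLaurent : ℤ[T;T⁻¹]) := by
  have := Fact.mk hN
  rw [Polynomial.cyclotomic_prime, quantumInt, map_sum, map_sum, Finset.mul_sum,
    ← Finset.sum_range_reflect]
  refine Finset.sum_congr rfl fun k hk => ?_
  have := Finset.mem_range.1 hk
  rw [map_pow, Polynomial.expand_X, ← pow_mul, Polynomial.toLaurent_X_pow,
    ← LaurentPolynomial.T_add]
  congr 1
  push_cast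
  omega

theorem expand_cyclotomic_mul (hN : N.Prime) (R : Type*) [CommRing R] :
    Polynomial.expand R 2 (Polynomial.cyclotomic N R) * (Polynomial.X ^ 2 - 1) =
      Polynomial.X ^ (2 * N) - 1 := by
  have := Fact.mk hN
  have h := congrArg (Polynomial.expand R 2) (Polynomial.cyclotomic_prime_mul_X_sub_one R N)
  simpa [← pow_mul] using h

/-- `Φ_m` is the minimal polynomial of `z`, and since `ℤ` is integrally closed the divisibility
already holds over `ℤ`, not only over `ℚ`. -/
theorem cyclotomic_dvd_of_aeval_eq_zero {m : ℕ} (hm : 0 < m) {z : ℂ} (hz : IsPrimitiveRoot z m)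
    {p : Polynomial ℤ} (hp : Polynomial.aeval z p = 0) : Polynomial.cyclotomic m ℤ ∣ p := by
  rw [Polynomial.cyclotomic_eq_minpoly hz hm]
  exact minpoly.isIntegrallyClosed_dvd (hz.isIntegral hm) hp

theorem aeval_cyclotomic_eq_zero_iff {m : ℕ} (hm : 0 < m) {z : ℂ} :
    Polynomial.aeval z (Polynomial.cyclotomic m ℤ) = 0 ↔ IsPrimitiveRoot z m := by
  have : NeZero (m : ℂ) := ⟨by exact_mod_cast hm.ne'⟩
  rw [← Polynomial.isRoot_cyclotomic_iff, Polynomial.IsRoot, ← Polynomial.map_cyclotomic_int m ℂ,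
    Polynomial.eval_map, Polynomial.aeval_def]
  rfl

/-- Since `ω² ≠ 1` and `(ω²)^N = 1` with `N` prime, `ω²` has order exactly `N`. -/
theorem aeval_expand_cyclotomic (hN : N.Prime) {ω : ℂ} (hω : ω ^ (2 * N) = 1) (h1 : ω ≠ 1)
    (h2 : ω ≠ -1) :
    Polynomial.aeval ω (Polynomial.expand ℤ 2 (Polynomial.cyclotomic N ℤ)) = 0 := by
  have := Fact.mk hN
  rw [Polynomial.expand_aeval, aeval_cyclotomic_eq_zero_iff hN.pos, IsPrimitiveRoot.iff_orderOf]
  refine orderOf_eq_prime (by rw [← pow_mul, hω]) fun h => ?_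
  rcases sq_eq_one_iff.1 h with h | h
  · exact h1 h
  · exact h2 h

/-- Here `Φ_N(q²) = Φ_{2N} Φ_N`, where `z` is a root of `Φ_N` and `-z` one of `Φ_{2N}`. The root `z`
splits off `Φ_N` from `r`. As `Φ_N(-z) ≠ 0`, the cofactor still vanishes at `-z`, which splits off
`Φ_{2N}`. -/
theorem expand_cyclotomic_dvd_of_isPrimitiveRoot (hN : N.Prime) (hodd : Odd N) {z : ℂ}
    (hz : IsPrimitiveRoot z N) {r : Polynomial ℤ} (hr : Polynomial.aeval z r = 0)
    (hr' : Polynomial.aeval (-z) r = 0) :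
    Polynomial.expand ℤ 2 (Polynomial.cyclotomic N ℤ) ∣ r := by
  have hneg : ¬ IsPrimitiveRoot (-z) N := fun h => by
    have := h.pow_eq_one
    rw [hodd.neg_pow, hz.pow_eq_one] at this
    norm_num at this
  have hz1 : z ≠ 1 := hz.ne_one hN.one_lt
  have hz2 : z ≠ -1 := by
    rintro rfl
    have := hz.pow_eq_one
    rw [hodd.neg_one_pow] at this
    norm_num at this
  have hexp : Polynomial.expand ℤ 2 (Polynomial.cyclotomic N ℤ) =
      Polynomial.cyclotomic (N * 2) ℤ * Polynomial.cyclotomic N ℤ :=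
    Polynomial.cyclotomic_expand_eq_cyclotomic_mul Nat.prime_two hodd.not_two_dvd_nat ℤ
  have hroot := aeval_expand_cyclotomic hN (ω := -z)
    (by rw [pow_mul, neg_sq, ← pow_mul, mul_comm, pow_mul, hz.pow_eq_one, one_pow])
    (fun h => hz2 (neg_eq_iff_eq_neg.1 h)) (fun h => hz1 (neg_injective h))
  have hΦ : Polynomial.aeval (-z) (Polynomial.cyclotomic N ℤ) ≠ 0 :=
    fun h => hneg ((aeval_cyclotomic_eq_zero_iff hN.pos).1 h)
  obtain ⟨r', rfl⟩ := cyclotomic_dvd_of_aeval_eq_zero hN.pos hz hr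
  rw [hexp, map_mul] at hroot
  rw [map_mul] at hr'
  rw [hexp, mul_comm]
  have h2N : 0 < N * 2 := by have := hN.pos; omega
  -- That `-z` is a primitive `2N`-th root follows from its being a root of `Φ_N(q²)` but not of
  -- `Φ_N`.
  exact mul_dvd_mul_left _ (cyclotomic_dvd_of_aeval_eq_zero h2N
    ((aeval_cyclotomic_eq_zero_iff h2N).1 ((mul_eq_zero.1 hroot).resolve_right hΦ))
    ((mul_eq_zero.1 hr').resolve_left hΦ))

/-- An integral polynomial is divisible by `[N]`, up to a power of the variable, if it vanishes at
a root of `[N]` and, for odd `N`, also at the opposite root. -/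
theorem expand_cyclotomic_dvd (hN : N.Prime) {ω : ℂ} (hω : ω ^ (2 * N) = 1) (h1 : ω ≠ 1)
    (h2 : ω ≠ -1) {r : Polynomial ℤ} (hr : Polynomial.aeval ω r = 0)
    (hr' : Odd N → Polynomial.aeval (-ω) r = 0) :
    Polynomial.expand ℤ 2 (Polynomial.cyclotomic N ℤ) ∣ r := by
  have := Fact.mk hN
  rcases hN.eq_two_or_odd' with rfl | hodd
  · have hroot := aeval_expand_cyclotomic hN hω h1 h2
    -- `Φ_2(q²) = Φ_4` is a single cyclotomic polynomial, so one root suffices.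
    rw [Polynomial.cyclotomic_expand_eq_cyclotomic Nat.prime_two dvd_rfl] at hroot ⊢
    exact cyclotomic_dvd_of_aeval_eq_zero (by simp)
      ((aeval_cyclotomic_eq_zero_iff (by simp)).1 hroot) hr
  -- Now `ω^N = 1` or `ω^N = -1`; accordingly `ω` or `-ω` is a primitive `N`-th root of unity.
  · rw [mul_comm, pow_mul, sq_eq_one_iff] at hω
    rcases hω with h | h
    · refine expand_cyclotomic_dvd_of_isPrimitiveRoot hN hodd
        (IsPrimitiveRoot.iff_orderOf.2 (orderOf_eq_prime h h1)) hr (hr' hodd)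
    · refine expand_cyclotomic_dvd_of_isPrimitiveRoot hN hodd (z := -ω)
        (IsPrimitiveRoot.iff_orderOf.2 (orderOf_eq_prime (by rw [hodd.neg_pow, h, neg_neg])
          fun h => h2 (neg_eq_iff_eq_neg.1 h))) (hr' hodd) (by rwa [neg_neg])

theorem evalAt_toLaurent (z : ℂˣ) (p : Polynomial ℤ) :
    evalAt z (p.toLaurent : ℤ[T;T⁻¹]) = Polynomial.aeval (z : ℂ) p := by
  rw [evalAt, LaurentPolynomial.eval₂_toLaurent, Polynomial.aeval_def]
  rfl

theorem quantumInt_dvd (hN : N.Prime) (z : ℂˣ) (hz : (z : ℂ) ^ (2 * N) = 1) (h1 : (z : ℂ) ≠ 1)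
    (h2 : (z : ℂ) ≠ -1) {R : ℤ[T;T⁻¹]} (hR : evalAt z R = 0)
    (hR' : Odd N → evalAt (-z) R = 0) : quantumInt N ∣ R := by
  -- Multiplication by a power of `q`, a unit, turns `R` into a polynomial without affecting
  -- divisibility or zeros.
  obtain ⟨n, r, hr⟩ := LaurentPolynomial.exists_T_pow R
  rw [quantumInt_eq hN, (LaurentPolynomial.isUnit_T _).mul_left_dvd,
    ← (LaurentPolynomial.isUnit_T (R := ℤ) n).dvd_mul_right, ← hr]
  refine map_dvd _ (expand_cyclotomic_dvd hN hz h1 h2 ?_ fun hodd => ?_)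
  · rw [← evalAt_toLaurent, hr, map_mul, hR, zero_mul]
  · rw [← Units.val_neg, ← evalAt_toLaurent, hr, map_mul, hR' hodd, zero_mul]

/-- This says that `z` is a simple root of `[N]`, which is inherited from `q^(2N) - 1`. -/
theorem exists_mapRingHom_quantumInt (hN : N.Prime) (z : ℂˣ) (hz : (z : ℂ) ^ (2 * N) = 1)
    (h1 : (z : ℂ) ≠ 1) (h2 : (z : ℂ) ≠ -1) :
    ∃ B : ℂ[T;T⁻¹], AddMonoidAlgebra.mapRingHom ℤ (Int.castRingHom ℂ) (quantumInt N) =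
      (T 1 - LaurentPolynomial.C (z : ℂ)) * B ∧
      LaurentPolynomial.eval₂ (RingHom.id ℂ) z B ≠ 0 := by
  have hroot := aeval_expand_cyclotomic hN hz h1 h2
  obtain ⟨b, hb⟩ := Polynomial.dvd_iff_isRoot.2 (show ((Polynomial.expand ℤ 2
    (Polynomial.cyclotomic N ℤ)).map (Int.castRingHom ℂ)).IsRoot z by
      rw [Polynomial.IsRoot, Polynomial.eval_map]; exact hroot)
  refine ⟨T (1 - (N : ℤ)) * b.toLaurent, ?_, ?_⟩
  · rw [quantumInt_eq hN, map_mul, mapRingHom_T, mapRingHom_toLaurent, hb, map_mul, map_sub,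
      Polynomial.toLaurent_X, Polynomial.toLaurent_C, mul_left_comm]
  · rw [map_mul, LaurentPolynomial.eval₂_T, LaurentPolynomial.eval₂_toLaurent]
    refine mul_ne_zero (Units.ne_zero _) fun h0 => ?_
    -- Differentiate `Φ_N(q²)(q² - 1) = q^(2N) - 1` at `z`: a double root of `Φ_N(q²)` would give `0
    -- = 2N z^(2N-1)`.
    have h := congrArg (fun p => Polynomial.eval (z : ℂ) (Polynomial.derivative p))
      (expand_cyclotomic_mul hN ℂ)
    rw [Polynomial.map_expand, Polynomial.map_cyclotomic_int] at hb
    have h0' : Polynomial.eval (z : ℂ) b = 0 := h0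
    simp only [hb, Polynomial.derivative_mul, Polynomial.derivative_sub, Polynomial.derivative_X_pow,
      Polynomial.derivative_X, Polynomial.derivative_C, Polynomial.derivative_one,
      Polynomial.eval_add, Polynomial.eval_sub, Polynomial.eval_mul, Polynomial.eval_X,
      Polynomial.eval_C, h0', sub_self, zero_mul, mul_zero, add_zero, sub_zero,
      Polynomial.eval_pow] at h
    refine mul_ne_zero ?_ (pow_ne_zero _ z.ne_zero) h.symm
    exact_mod_cast (show 2 * N ≠ 0 by simp [hN.ne_zero])

/-- The nullity at a root of `[N]` of a Laurent polynomial whose value at `q = 1` is a power of `N`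
is the multiplicity of the factor `[N]`. -/
theorem nullity_eq_emultiplicity (hN : N.Prime) {P : ℤ[T;T⁻¹]} (hP : Odd N → negVar P = P) {m : ℕ}
    (hP1 : evalOne P = (N : ℤ) ^ m) {ω : ℂ} (hω : ω ^ (2 * N) = 1) (h1 : ω ≠ 1) (h2 : ω ≠ -1) :
    nullity ω P = emultiplicity (quantumInt N) P ∧ nullity ω P ≤ m := by
  -- Evaluation at `q = 1` sends `[N]` to `N`, so `[N] ^ ν ∣ P` gives `N ^ ν ∣ N ^ m`.
  have hbound : ∀ ν, quantumInt N ^ ν ∣ P → ν ≤ m := fun ν h => by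
    have := map_dvd evalOne h
    rw [map_pow, evalOne_quantumInt, hP1] at this
    exact (Nat.pow_dvd_pow_iff_le_right hN.one_lt).1 (by exact_mod_cast this)
  have hfin : FiniteMultiplicity (quantumInt N) P :=
    ⟨m, fun h => absurd (hbound _ h) (by omega)⟩
  obtain ⟨R, hR, hndvd⟩ := hfin.exists_eq_pow_mul_and_not_dvd
  lift ω to ℂˣ using IsUnit.of_pow_eq_one hω (by have := hN.pos; omega)
  obtain ⟨B, hB, hB0⟩ := exists_mapRingHom_quantumInt hN ω hω h1 h2
  -- A zero of `R` at `ω` would make `R` divisible by `[N]`. For odd `N` this also needs `R(-ω) =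
  -- 0`: both `P` and `[N]` are invariant under `q ↦ -q`, hence so is the quotient `R`.
  have hRω : evalAt ω R ≠ 0 := fun h => hndvd (quantumInt_dvd hN ω hω h1 h2 h fun hodd => by
    have hneg : negVar R = R := by
      have h3 := hP hodd
      generalize multiplicity (quantumInt N) P = μ at hR
      rw [hR, map_mul, map_pow, negVar_quantumInt hodd] at h3
      exact mul_left_cancel₀ (pow_ne_zero _ (quantumInt_ne_zero hN.ne_zero)) h3
    rw [← evalAt_negVar, hneg, h])
  have hnull := nullity_pow_mul ω (multiplicity (quantumInt N) P) hB hB0 hRω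
  rw [← hR] at hnull
  rw [hnull, ← hfin.emultiplicity_eq_multiplicity]
  refine ⟨rfl, ?_⟩
  rw [hfin.emultiplicity_eq_multiplicity]
  exact_mod_cast hbound _ (pow_multiplicity_dvd _ _)

end Nullity

end OrientedLink

theorem lemma1p1 :
    (∀ (L : OrientedLink.Link) (n : ℕ), L.HasComponents n →
      1 ≤ n ∧
      OrientedLink.nullity Complex.I (OrientedLink.V 2 L) =
        emultiplicity (T 1 + T (-1)) (OrientedLink.V 2 L) ∧
      OrientedLink.evalOne (OrientedLink.V 2 L) = 2 ^ (n - 1) ∧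
      0 ≤ OrientedLink.nullity Complex.I (OrientedLink.V 2 L) ∧
      OrientedLink.nullity Complex.I (OrientedLink.V 2 L) ≤ (n - 1 : ℕ)) ∧
    (∀ (N : ℕ), N.Prime → ∀ (ω : ℂ), ω ^ (2 * N) = 1 → ω ≠ 1 → ω ≠ -1 →
      ∀ (L : OrientedLink.Link) (n : ℕ), L.HasComponents n →
        OrientedLink.nullity ω (OrientedLink.V N L) =
          emultiplicity (OrientedLink.quantumInt N) (OrientedLink.V N L) ∧
        OrientedLink.evalOne (OrientedLink.V N L) = (N : ℤ) ^ (n - 1) ∧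
        0 ≤ OrientedLink.nullity ω (OrientedLink.V N L) ∧
        OrientedLink.nullity ω (OrientedLink.V N L) ≤ (n - 1 : ℕ)) := by
  refine ⟨fun L n h => ?_, fun N hN ω hω h1 h2 L n h => ?_⟩
  -- The Jones case is `N = 2`, `ω = i`, with `[2] = q + q⁻¹`. The parity hypothesis is void because
  -- `2` is not odd.
  · have hI : Complex.I ≠ 1 ∧ Complex.I ≠ -1 := by
      constructor <;> intro h <;> simpa using congrArg Complex.im h
    have h3 := OrientedLink.nullity_eq_emultiplicity Nat.prime_two
      (P := OrientedLink.V 2 L) (fun h => absurd h (by decide)) (h.evalOne_V_eq two_ne_zero)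
      (ω := Complex.I) (by rw [pow_mul, Complex.I_sq]; norm_num) hI.1 hI.2
    have h4 : OrientedLink.quantumInt 2 = T 1 + T (-1) := by
      simp [OrientedLink.quantumInt, Finset.sum_range_succ]
    rw [h4] at h3
    exact ⟨h.one_le, h3.1, by simpa using h.evalOne_V_eq two_ne_zero, zero_le, h3.2⟩
  · have h3 := OrientedLink.nullity_eq_emultiplicity hN
      (fun hodd => OrientedLink.negVar_V hodd L) (h.evalOne_V_eq hN.ne_zero) hω h1 h2
    exact ⟨h3.1, h.evalOne_V_eq hN.ne_zero, zero_le, h3.2⟩
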